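/- **Conventions.** A model category is a category with finite limits and finite colimits together with classes of fibrations, cofibrations and weak equivalences satisfying the lifting, factorization, retract and 2-out-of-3 axioms. An initial object $\emptyset$ is strict if every morphism into it is an isomorphism. Let $\mathcal M$ be a model category with strict initial object, $I$ a set and $\Phi$ a filter of subsets of $I$ (possibly containing the empty set). For $J\in\Phi$ let $U_J\in\prod_I\mathcal M$ be the subterminal object which is terminal at the indices $i\in J$ and initial at the indices $i\notin J$. The filter product $\prod_\Phi\mathcal M$ has the objects of $\prod_I\mathcal M$; a morphism $X\to Y$ in it is an equivalence class of morphisms $X\times U_J\to Y$ of $\prod_I\mathcal M$ with $J\in\Phi$, two of them being equivalent if they agree on $X\times U_K$ for some smaller $K\in\Phi$. Let $P_\Phi\colon\prod_I\mathcal M\to\prod_\Phi\mathcal M$ be the projection functor. A morphism of $\prod_\Phi\mathcal M$ is called a (co)fibration, resp. weak equivalence, if for some $J\in\Phi$ it has a representative $f\colon X\times U_J\to Y$ for which $(f,\mathrm{pr}_2)\colon X\times U_J\to Y\times U_J$ is componentwise a (co)fibration, resp. weak equivalence, of $\mathcal M$. A Quillen adjunction is a *homotopical localization* (resp. *colocalization*)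 if its derived counit (resp. derived unit) is a weak equivalence. Let $\mathcal V$ be a monoidal model category. A *compactly $\mathcal V$-enriched* model category is a model category $\mathcal M$ with an enrichment of the category $\mathcal M$ in $\mathcal V$, with mapping objects $\mathrm{Map}(X,Y)$, and with functorial tensors $X\otimes K$ and cotensors $Y^K$ by the compact objects $K$ of $\mathcal V$ and natural bijections $\mathrm{Hom}(X\otimes K,Y)\cong\mathrm{Hom}(X,Y^K)\cong\mathrm{Hom}_{\mathcal V}(K,\mathrm{Map}(X,Y))$, such that for every cofibration $A\to B$ and fibration $Y\to X$ the map $\mathrm{Map}(B,Y)\to\mathrm{Map}(B,X)\times_{\mathrm{Map}(A,X)}\mathrm{Map}(A,Y)$ is a fibration, which is trivial if one of the two given maps is. The category $\mathcal V$ is *quotient compatible* if it has filtered colimits, $\otimes$ commutes with filtered colimits, the unit is compact, and fibrations and trivial fibrations are closed under filtered colimits. An adjunction between $\mathcal V$-enriched categories is *enriched* if both functors are $\mathcal V$-functors and the unit and the counit are $\mathcal V$-natural. **Statement.** Let $\mathcal M,\mathcal N$ be model categories with strict initial objects, $I$ a set, $\Phi$ a filter of subsets of $I$, and $F\colon\mathcal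 M\rightleftarrows\mathcal N\colon G$ a Quillen adjunction ($F\dashv G$) such that $F$ preserves the terminal object and $G$ preserves the initial object. Then $\prod_\Phi\mathcal M$ and $\prod_\Phi\mathcal N$, with the classes above, are model categories, and there is an induced Quillen adjunction $\prod_I F\dashv\prod_I G$ between them: its functors are compatible, via the projections $P_\Phi$, with the componentwise functors $\prod_I F$ and $\prod_I G$, and its unit is induced by the componentwise unit. If $(F,G)$ is a homotopical localization, a homotopical colocalization, or a Quillen equivalence, then so is $(\prod_I F,\prod_I G)$. Moreover, let $\mathcal V$ be a quotient compatible monoidal model category in which products indexed by subsets of $I$ exist and filtered colimits commute with finite limits. If $\mathcal M,\mathcal N$ are compactly $\mathcal V$-enriched and the adjunction $(F,G)$ is enriched, then $\prod_\Phi\mathcal M$ and $\prod_\Phi\mathcal N$ are compactly $\mathcal V$-enriched, with mapping objects $$\mathrm{Map}(X,Y)=\operatorname{colim}_{J\in\Phi}\ \prod_{i\in J}\mathrm{Map}(X_i,Y_i)$$ and with the identities, the composition and the identification of morphisms induced from those of $\mathcal M$ and $\mathcal N$, and for these enrichments the adjunction $(\prod_I F,\prod_I G)$ is enriched. -/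

import Mathlib

open CategoryTheory CategoryTheory.Limits HomotopicalAlgebra MonoidalCategory Opposite

universe w v v₁ v₂ v₃ u u₁ u₂ u₃

noncomputable section

namespace FilterModel

/-! ### Filter quotient categories -/

section FilterQuotient

variable {C : Type u} [Category.{v} C] [HasBinaryProducts C]
  {P : Type w} [SemilatticeInf P]

/-- The objects of the filter quotient of `C` by a downward directed family `U` of (subterminal)
objects of `C`: the objects of `C`. -/
structure FilterQuotient {C : Type u} [Category.{v} C] {P : Type w} [SemilatticeInf P]
    (U : P ⥤ C) where
  /-- The underlying object of `C`. -/
  as : C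

namespace FilterQuotient

variable {U : P ⥤ C}

/-- The composite `X × U r ⟶ X × U p ⟶ Y` for `r ≤ p`. -/
def res {X Y : C} {p r : P} (h : r ≤ p) (f : X ⨯ U.obj p ⟶ Y) : X ⨯ U.obj r ⟶ Y :=
  prod.map (𝟙 X) (U.map (homOfLE h)) ≫ f

lemma res_refl {X Y : C} {p : P} (f : X ⨯ U.obj p ⟶ Y) : res le_rfl f = f := by
  simp [res]

lemma res_res {X Y : C} {p q r : P} (h : q ≤ p) (h' : r ≤ q) (f : X ⨯ U.obj p ⟶ Y) :
    res h' (res h f) = res (h'.trans h) f := by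
  have : homOfLE (h'.trans h) = homOfLE h' ≫ homOfLE h := rfl
  simp only [res, this, Functor.map_comp, ← Category.assoc]
  congr 1
  ext <;> simp

/-- The morphism `X × U r ⟶ Y × U r` with components `f` and the projection: this is `f × U r`. -/
def graph {X Y : C} {r : P} (f : X ⨯ U.obj r ⟶ Y) : X ⨯ U.obj r ⟶ Y ⨯ U.obj r :=
  prod.lift f prod.snd

lemma graph_comp_graph {X Y Z : C} {p : P} (f : X ⨯ U.obj p ⟶ Y) (g : Y ⨯ U.obj p ⟶ Z) :
    graph (graph f ≫ g) = graph f ≫ graph g := by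
  refine Limits.prod.hom_ext ?_ ?_ <;> simp only [graph, Category.assoc, prod.lift_fst,
    prod.lift_snd]

lemma res_graph_comp {X Y Z : C} {p r : P} (h : r ≤ p) (f : X ⨯ U.obj p ⟶ Y)
    (g : Y ⨯ U.obj p ⟶ Z) : res h (graph f ≫ g) = graph (res h f) ≫ res h g := by
  simp only [res, graph, ← Category.assoc]
  congr 1
  ext <;> simp

variable (U) in
/-- The representatives of morphisms `X ⟶ Y` in the filter quotient. -/
def Rep (X Y : C) := Σ p : P, (X ⨯ U.obj p ⟶ Y)

/-- Two representatives are equivalent if they agree on `X × U r` for some smaller `r`. -/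
instance repSetoid (X Y : C) : Setoid (Rep U X Y) where
  r a b := ∃ (r : P) (ha : r ≤ a.1) (hb : r ≤ b.1), res ha a.2 = res hb b.2
  iseqv :=
    { refl := fun a => ⟨a.1, le_rfl, le_rfl, rfl⟩
      symm := fun ⟨r, ha, hb, h⟩ => ⟨r, hb, ha, h.symm⟩
      trans := by
        rintro a b c ⟨r, ha, hb, h⟩ ⟨s, hb', hc, h'⟩
        refine ⟨r ⊓ s, inf_le_left.trans ha, inf_le_right.trans hc, ?_⟩
        rw [← res_res ha inf_le_left, h, res_res, ← res_res hc inf_le_right, ← h', res_res] }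

variable (U) in
/-- Morphisms `X ⟶ Y` in the filter quotient: equivalence classes of morphisms `X × U p ⟶ Y`. -/
def Hom (X Y : C) := Quotient (repSetoid (U := U) X Y)

/-- The class of a morphism `X × U p ⟶ Y`. -/
def Hom.mk {X Y : C} {p : P} (f : X ⨯ U.obj p ⟶ Y) : Hom U X Y :=
  Quotient.mk _ ⟨p, f⟩

lemma Hom.mk_eq {X Y : C} {p q r : P} (hp : r ≤ p) (hq : r ≤ q) {f : X ⨯ U.obj p ⟶ Y}
    {g : X ⨯ U.obj q ⟶ Y} (h : res hp f = res hq g) : Hom.mk f = Hom.mk g :=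
  Quotient.sound ⟨r, hp, hq, h⟩

lemma Hom.mk_res {X Y : C} {p r : P} (h : r ≤ p) (f : X ⨯ U.obj p ⟶ Y) :
    Hom.mk (res h f) = Hom.mk f :=
  Hom.mk_eq (r := r) le_rfl h (res_refl _)

/-- Composition of representatives, on `X × U (p ⊓ q)`: restrict both to `U (p ⊓ q)` and form
`X × U (p ⊓ q) ⟶ Y × U (p ⊓ q) ⟶ Z`. -/
def Hom.comp {X Y Z : C} (a : Hom U X Y) (b : Hom U Y Z) : Hom U X Z :=
  Quotient.liftOn₂ a b
    (fun a b => Hom.mk (p := a.1 ⊓ b.1)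
      (graph (res inf_le_left a.2) ≫ res inf_le_right b.2)) (by
    rintro a b a' b' ⟨r, ha, ha', h⟩ ⟨s, hb, hb', h'⟩
    refine Hom.mk_eq (r := r ⊓ s) (le_inf (inf_le_left.trans ha) (inf_le_right.trans hb))
      (le_inf (inf_le_left.trans ha') (inf_le_right.trans hb')) ?_
    rw [res_graph_comp, res_graph_comp, res_res, res_res, res_res, res_res,
      ← res_res ha inf_le_left, h, res_res, ← res_res hb inf_le_right, h', res_res])

lemma Hom.mk_comp_mk {X Y Z : C} {p : P} (f : X ⨯ U.obj p ⟶ Y) (g : Y ⨯ U.obj p ⟶ Z) :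
    (Hom.mk f).comp (Hom.mk g) = Hom.mk (graph f ≫ g) := by
  refine Hom.mk_eq (r := p ⊓ p) le_rfl inf_le_left ?_
  rw [res_refl, res_graph_comp]

lemma Hom.exists_mk {X Y : C} (a : Hom U X Y) :
    ∃ (p : P), ∀ r ≤ p, ∃ f : X ⨯ U.obj r ⟶ Y, Hom.mk f = a := by
  obtain ⟨p, f⟩ := a
  exact ⟨p, fun r h => ⟨res h f, Hom.mk_res h f⟩⟩

variable [OrderTop P]

instance : Category (FilterQuotient U) where
  Hom X Y := Hom U X.as Y.as
  id X := Hom.mk (p := (⊤ : P)) prod.fst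
  comp a b := Hom.comp a b
  id_comp {X Y} a := by
    obtain ⟨p, hp⟩ := Hom.exists_mk a
    obtain ⟨f, rfl⟩ := hp p le_rfl
    rw [← Hom.mk_res (le_top : p ≤ ⊤) prod.fst, Hom.mk_comp_mk]
    congr 1
    have : graph (res (U := U) (le_top : p ≤ ⊤) (prod.fst : X.as ⨯ U.obj ⊤ ⟶ _)) = 𝟙 _ := by
      dsimp [graph, res]
      ext <;> simp
    rw [this, Category.id_comp]
  comp_id {X Y} a := by
    obtain ⟨p, hp⟩ := Hom.exists_mk a
    obtain ⟨f, rfl⟩ := hp p le_rfl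
    rw [← Hom.mk_res (le_top : p ≤ ⊤) prod.fst, Hom.mk_comp_mk]
    congr 1
    simp only [graph, res, prod.map_fst, Category.comp_id]
    exact prod.lift_fst _ _
  assoc {W X Y Z} a b c := by
    obtain ⟨p, hp⟩ := Hom.exists_mk a
    obtain ⟨q, hq⟩ := Hom.exists_mk b
    obtain ⟨r, hr⟩ := Hom.exists_mk c
    obtain ⟨f, rfl⟩ := hp (p ⊓ q ⊓ r) (inf_le_left.trans inf_le_left)
    obtain ⟨g, rfl⟩ := hq (p ⊓ q ⊓ r) (inf_le_left.trans inf_le_right)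
    obtain ⟨h, rfl⟩ := hr (p ⊓ q ⊓ r) inf_le_right
    simp only [Hom.mk_comp_mk]
    rw [graph_comp_graph, Category.assoc]

/-- The morphism of the filter quotient represented by `f : X × U p ⟶ Y`. -/
def homMk {X Y : FilterQuotient U} {p : P} (f : X.as ⨯ U.obj p ⟶ Y.as) : X ⟶ Y :=
  Hom.mk f

variable (U) in
/-- The projection functor: the identity on objects, and a morphism goes to its class. -/
def projection : C ⥤ FilterQuotient U where
  obj X := ⟨X⟩
  map f := homMk (p := (⊤ : P)) (prod.fst ≫ f)
  map_id X := by
    simp only [Category.comp_id]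
    rfl
  map_comp {X Y Z} f g := by
    refine Eq.trans ?_ (Hom.mk_comp_mk (U := U) (p := ⊤) (prod.fst ≫ f) (prod.fst ≫ g)).symm
    rw [graph, prod.lift_fst_assoc, Category.assoc]
    rfl

/-- For a class `S` of morphisms of `C` (stable under products with the `U p`), the class of
the morphisms `φ` of the filter quotient such that `φ × U p` belongs to `S` for some `p`. -/
def propertyQuotient (S : MorphismProperty C) : MorphismProperty (FilterQuotient U) :=
  fun X Y φ => ∃ (p : P) (f : X.as ⨯ U.obj p ⟶ Y.as), φ = homMk f ∧ S (graph f)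

end FilterQuotient

end FilterQuotient

/-! ### Filter products -/

section FilterProduct

variable (M : Type u) [Category.{v} M] {I : Type w} (Φ : Filter I)

instance instHasBinaryProductsPi [HasBinaryProducts M] : HasBinaryProducts (I → M) := by
  have (X Y : I → M) : HasLimit (pair X Y) := HasLimit.mk
    { cone := BinaryFan.mk (P := fun i => X i ⨯ Y i) (fun i => prod.fst) (fun i => prod.snd)
      isLimit := BinaryFan.IsLimit.mk _ (fun f g i => prod.lift (f i) (g i))
        (fun f g => funext fun i => prod.lift_fst _ _)
        (fun f g => funext fun i => prod.lift_snd _ _)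
        (fun f g m hf hg => funext fun i => by
          refine Limits.prod.hom_ext ?_ ?_
          · exact (congrFun hf i).trans (prod.lift_fst _ _).symm
          · exact (congrFun hg i).trans (prod.lift_snd _ _).symm) }
  exact hasBinaryProducts_of_hasLimit_pair _

/-- The members of the filter `Φ`, ordered by inclusion. -/
abbrev Members : Type w := {J : Set I // J ∈ Φ}

instance : SemilatticeInf (Members Φ) := Subtype.semilatticeInf fun _ _ => Filter.inter_mem

instance : OrderTop (Members Φ) := Subtype.orderTop Filter.univ_mem

variable {Φ} [HasInitial M] [HasTerminal M]

open Classical in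
/-- The subterminal object of `∏_I M` attached to a subset `J` of `I`: terminal at the indices
in `J`, initial at the others. -/
def indicator (J : Set I) : I → M := fun i => if i ∈ J then ⊤_ M else ⊥_ M

variable {M} in
lemma indicator_hom_ext {J K : Set I} (h : J ⊆ K) (f g : indicator M J ⟶ indicator M K) :
    f = g := by
  funext i
  by_cases hi : i ∈ K
  · have e : indicator M K i = ⊤_ M := if_pos hi
    rw [← cancel_mono (eqToHom e)]
    exact Subsingleton.elim _ _
  · have e : indicator M J i = ⊥_ M := if_neg fun hJ => hi (h hJ)
    rw [← cancel_epi (eqToHom e.symm)]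
    exact Subsingleton.elim _ _

open Classical in
/-- The morphism `indicator M J ⟶ indicator M K` for `J ⊆ K`. -/
def indicatorMap {J K : Set I} (h : J ⊆ K) : indicator M J ⟶ indicator M K := fun i =>
  if hi : i ∈ K then terminal.from _ ≫ eqToHom (if_pos hi).symm
  else eqToHom (if_neg fun hJ => hi (h hJ)) ≫ initial.to _

variable (Φ) in
/-- The family of subterminal objects of `∏_I M` attached to the members of `Φ`. -/
def subterminals : Members Φ ⥤ (I → M) where
  obj J := indicator M J.1
  map f := indicatorMap M (leOfHom f)
  map_id _ := indicator_hom_ext subset_rfl _ _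
  map_comp f g := indicator_hom_ext ((leOfHom f).trans (leOfHom g)) _ _

variable (Φ) [HasBinaryProducts M]

/-- The filter product `∏_Φ M`: the filter quotient of `∏_I M` by the family of subterminal
objects attached to `Φ`. -/
abbrev FilterProduct := FilterQuotient (subterminals M Φ)

/-- The projection functor `∏_I M ⥤ ∏_Φ M`. -/
abbrev proj : (I → M) ⥤ FilterProduct M Φ := FilterQuotient.projection (subterminals M Φ)

/-- For a class `S` of morphisms of `M`, the class of morphisms of `∏_Φ M` induced by the class of
the morphisms of `∏_I M` that are componentwise in `S`. -/
abbrev productProperty (S : MorphismProperty M) : MorphismProperty (FilterProduct M Φ) :=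
  FilterQuotient.propertyQuotient (MorphismProperty.pi fun _ : I => S)

variable {M Φ}

open Classical in
/-- A family of morphisms `X i ⟶ Y i`, `i ∈ J`, regarded as a morphism `X × indicator J ⟶ Y`
of `∏_I M` (at the other indices, `X i × ∅ ⟶ ∅ ⟶ Y i`). -/
def ofFamily {X Y : I → M} {J : Members Φ} (f : ∀ i : J.1, X i ⟶ Y i) :
    X ⨯ (subterminals M Φ).obj J ⟶ Y := fun i =>
  if hi : i ∈ J.1 then (prod.fst : X ⨯ (subterminals M Φ).obj J ⟶ X) i ≫ f ⟨i, hi⟩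
  else (prod.snd : X ⨯ (subterminals M Φ).obj J ⟶ _) i ≫ eqToHom (if_neg hi) ≫ initial.to (Y i)

/-- The morphism of `∏_Φ M` given by a family of morphisms `X i ⟶ Y i`, `i ∈ J`. -/
def germ {X Y : I → M} {J : Members Φ} (f : ∀ i : J.1, X i ⟶ Y i) :
    (proj M Φ).obj X ⟶ (proj M Φ).obj Y :=
  FilterQuotient.homMk (X := ⟨X⟩) (Y := ⟨Y⟩) (ofFamily f)

end FilterProduct

/-- The model structure given on `∏_Φ M` is the one induced by that of `M`. -/
structure IsFilterProductModel (M : Type u) [Category.{v} M] [ModelCategory M] {I : Type w}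
    (Φ : Filter I) [ModelCategory (FilterProduct M Φ)] : Prop where
  fibrations_eq : fibrations (FilterProduct M Φ) = productProperty M Φ (fibrations M)
  cofibrations_eq : cofibrations (FilterProduct M Φ) = productProperty M Φ (cofibrations M)
  weakEquivalences_eq :
    weakEquivalences (FilterProduct M Φ) = productProperty M Φ (weakEquivalences M)

/-! ### Quillen adjunctions -/

section Quillen

variable {M : Type u₁} [Category.{v₁} M] [ModelCategory M]
  {N : Type u₂} [Category.{v₂} N] [ModelCategory N] {F : M ⥤ N} {G : N ⥤ M}

/-- A Quillen adjunction: the left adjoint preserves cofibrations and trivial cofibrations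
(equivalently, the right adjoint preserves fibrations and trivial fibrations). -/
structure IsQuillenAdjunction (_ : F ⊣ G) : Prop where
  cofibration {X Y : M} (f : X ⟶ Y) : Cofibration f → Cofibration (F.map f)
  trivialCofibration {X Y : M} (f : X ⟶ Y) :
    Cofibration f → WeakEquivalence f → WeakEquivalence (F.map f)

/-- The derived counit `F Q ⟶ F (G Y) ⟶ Y` is a weak equivalence, for all fibrant `Y` and all
cofibrant replacements `Q ⟶ G Y`; that is, the right derived functor is fully faithful. -/
def IsHomotopicalLocalization (adj : F ⊣ G) : Prop :=
  ∀ (Y : N) (Q : M) (q : Q ⟶ G.obj Y), IsFibrant Y → IsCofibrant Q → WeakEquivalence q →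
    WeakEquivalence (F.map q ≫ adj.counit.app Y)

/-- The derived unit `X ⟶ G (F X) ⟶ G R` is a weak equivalence, for all cofibrant `X` and all
fibrant replacements `F X ⟶ R`; that is, the left derived functor is fully faithful. -/
def IsHomotopicalColocalization (adj : F ⊣ G) : Prop :=
  ∀ (X : M) (R : N) (j : F.obj X ⟶ R), IsCofibrant X → IsFibrant R → WeakEquivalence j →
    WeakEquivalence (adj.unit.app X ≫ G.map j)

/-- A Quillen equivalence: for cofibrant `X` and fibrant `Y`, a morphism `F X ⟶ Y` is a weak
equivalence if and only if its transpose `X ⟶ G Y` is one. -/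
def IsQuillenEquivalence (adj : F ⊣ G) : Prop :=
  IsQuillenAdjunction adj ∧
  ∀ (X : M) (Y : N) (f : F.obj X ⟶ Y), IsCofibrant X → IsFibrant Y →
    (WeakEquivalence f ↔ WeakEquivalence (adj.homEquiv X Y f))

/-- `adj'` is the adjunction between filter products that is induced by `adj`: its functors
are the ones induced on the quotients by `∏_I F` and `∏_I G`, and its unit is the one induced by
the componentwise unit of `adj`. -/
def IsInducedAdjunction (adj : F ⊣ G) {I : Type w} (Φ : Filter I)
    {F' : FilterProduct M Φ ⥤ FilterProduct N Φ} {G' : FilterProduct N Φ ⥤ FilterProduct M Φ}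
    (adj' : F' ⊣ G') : Prop :=
  ∃ (eF : proj M Φ ⋙ F' ≅ Functor.pi (fun _ : I => F) ⋙ proj N Φ)
    (eG : proj N Φ ⋙ G' ≅ Functor.pi (fun _ : I => G) ⋙ proj M Φ),
    ∀ X : I → M,
      adj'.unit.app ((proj M Φ).obj X) ≫ G'.map (eF.hom.app X) ≫ eG.hom.app (fun i => F.obj (X i)) =
        (proj M Φ).map (X := X) (Y := fun i => G.obj (F.obj (X i))) fun i => adj.unit.app (X i)

end Quillen

/-! ### Enriched model categories -/

section Enriched

/-- Monoidal model categories: the pushout product axiom and the unit axiom. (Closedness and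
symmetry of the monoidal structure are not required.) -/
class MonoidalModelCategory (V : Type u) [Category.{v} V] [MonoidalCategory V]
    [ModelCategory V] : Prop where
  cofibration_pushoutProduct {A B C D : V} (i : A ⟶ B) (j : C ⟶ D) :
    Cofibration i → Cofibration j →
      Cofibration (pushout.desc (f := i ▷ C) (g := A ◁ j) (B ◁ j) (i ▷ D)
        (whisker_exchange i j).symm)
  weakEquivalence_pushoutProduct {A B C D : V} (i : A ⟶ B) (j : C ⟶ D) :
    Cofibration i → Cofibration j → (WeakEquivalence i ∨ WeakEquivalence j) →
      WeakEquivalence (pushout.desc (f := i ▷ C) (g := A ◁ j) (B ◁ j) (i ▷ D)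
        (whisker_exchange i j).symm)
  unit_left {Q X : V} (q : Q ⟶ 𝟙_ V) :
    IsCofibrant Q → WeakEquivalence q → IsCofibrant X → WeakEquivalence (q ▷ X)
  unit_right {Q X : V} (q : Q ⟶ 𝟙_ V) :
    IsCofibrant Q → WeakEquivalence q → IsCofibrant X → WeakEquivalence (X ◁ q)

/-- Quotient compatible monoidal model categories. -/
class QuotientCompatible (V : Type u) [Category.{v} V] [MonoidalCategory V]
    [ModelCategory V] : Prop where
  hasFilteredColimits : HasFilteredColimitsOfSize.{w, w} V
  tensorLeft_preserves (X : V) : PreservesFilteredColimitsOfSize.{w, w} (tensorLeft X)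
  tensorRight_preserves (X : V) : PreservesFilteredColimitsOfSize.{w, w} (tensorRight X)
  unit_compact : IsFinitelyPresentable.{w} (𝟙_ V)
  fibrations_stable : MorphismProperty.IsStableUnderFilteredColimits.{w, w} (fibrations V)
  trivialFibrations_stable :
    MorphismProperty.IsStableUnderFilteredColimits.{w, w} (trivialFibrations V)

attribute [instance] QuotientCompatible.hasFilteredColimits

/-- The full subcategory of compact objects: those `K` for which `Hom(K, -)` commutes with
filtered colimits. -/
abbrev CompactObj (V : Type u) [Category.{v} V] :=
  (ObjectProperty.isFinitelyPresentable.{w} V).FullSubcategory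

/-- Compactly `V`-enriched structures on a model category `M`: an enrichment of the category `M`,
tensors and cotensors by compact objects of `V`, and the pullback-hom axiom. -/
class CompactlyEnriched (V : Type u₁) [Category.{v₁} V] [MonoidalCategory V] [ModelCategory V]
    (M : Type u₂) [Category.{v₂} M] [ModelCategory M] extends EnrichedOrdinaryCategory V M where
  /-- The tensor `X ⊗ K`. -/
  tensor : M ⥤ CompactObj.{w} V ⥤ M
  /-- The cotensor `Y ^ K`. -/
  cotensor : (CompactObj.{w} V)ᵒᵖ ⥤ M ⥤ M
  /-- `Hom(X ⊗ K, Y) ≅ Hom(K, Map(X, Y))` -/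
  tensorHomEquiv (X Y : M) (K : CompactObj.{w} V) :
    ((tensor.obj X).obj K ⟶ Y) ≃ (K.obj ⟶ (X ⟶[V] Y))
  /-- `Hom(X, Y ^ K) ≅ Hom(K, Map(X, Y))` -/
  cotensorHomEquiv (X Y : M) (K : CompactObj.{w} V) :
    (X ⟶ (cotensor.obj (op K)).obj Y) ≃ (K.obj ⟶ (X ⟶[V] Y))
  tensorHomEquiv_naturality {X X' Y Y' : M} {K K' : CompactObj.{w} V} (f : X' ⟶ X) (g : Y ⟶ Y')
    (k : K' ⟶ K) (φ : (tensor.obj X).obj K ⟶ Y) :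
    tensorHomEquiv X' Y' K' ((tensor.map f).app K' ≫ (tensor.obj X).map k ≫ φ ≫ g) =
      k.hom ≫ tensorHomEquiv X Y K φ ≫ eHomWhiskerRight V f Y ≫ eHomWhiskerLeft V X' g
  cotensorHomEquiv_naturality {X X' Y Y' : M} {K K' : CompactObj.{w} V} (f : X' ⟶ X) (g : Y ⟶ Y')
    (k : K' ⟶ K) (φ : X ⟶ (cotensor.obj (op K)).obj Y) :
    cotensorHomEquiv X' Y' K' (f ≫ φ ≫ (cotensor.map k.op).app Y ≫ (cotensor.obj (op K')).map g) =
      k.hom ≫ cotensorHomEquiv X Y K φ ≫ eHomWhiskerRight V f Y ≫ eHomWhiskerLeft V X' g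
  fibration_pullbackHom {A B X Y : M} (i : A ⟶ B) (p : Y ⟶ X) : Cofibration i → Fibration p →
    Fibration (pullback.lift (f := eHomWhiskerRight V i X) (g := eHomWhiskerLeft V A p)
      (eHomWhiskerLeft V B p) (eHomWhiskerRight V i Y) (eHom_whisker_exchange V i p))
  weakEquivalence_pullbackHom {A B X Y : M} (i : A ⟶ B) (p : Y ⟶ X) : Cofibration i →
    Fibration p → (WeakEquivalence i ∨ WeakEquivalence p) →
    WeakEquivalence (pullback.lift (f := eHomWhiskerRight V i X) (g := eHomWhiskerLeft V A p)
      (eHomWhiskerLeft V B p) (eHomWhiskerRight V i Y) (eHom_whisker_exchange V i p))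

variable (V : Type u) [Category.{v} V] [MonoidalCategory V]

/-- The structure of a `V`-functor on a functor between `V`-enriched categories. -/
structure EnrichedStructure {C : Type u₁} [Category.{v₁} C] [EnrichedOrdinaryCategory V C]
    {D : Type u₂} [Category.{v₂} D] [EnrichedOrdinaryCategory V D] (F : C ⥤ D) where
  /-- The action on mapping objects. -/
  map (X Y : C) : (X ⟶[V] Y) ⟶ (F.obj X ⟶[V] F.obj Y)
  map_id (X : C) : eId V X ≫ map X X = eId V (F.obj X)
  map_comp (X Y Z : C) : eComp V X Y Z ≫ map X Z =
    (map X Y ⊗ₘ map Y Z) ≫ eComp V (F.obj X) (F.obj Y) (F.obj Z)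
  homEquiv_map {X Y : C} (f : X ⟶ Y) : eHomEquiv V f ≫ map X Y = eHomEquiv V (F.map f)

/-- The structure of a `V`-enriched adjunction on an adjunction between `V`-enriched categories:
both functors are `V`-functors, and the unit and the counit are `V`-natural. -/
structure EnrichedAdjunction {C : Type u₁} [Category.{v₁} C] [EnrichedOrdinaryCategory V C]
    {D : Type u₂} [Category.{v₂} D] [EnrichedOrdinaryCategory V D] {F : C ⥤ D} {G : D ⥤ C}
    (adj : F ⊣ G) where
  /-- The left adjoint is a `V`-functor. -/
  left : EnrichedStructure V F
  /-- The right adjoint is a `V`-functor. -/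
  right : EnrichedStructure V G
  unit_naturality (X Y : C) :
    left.map X Y ≫ right.map (F.obj X) (F.obj Y) ≫
        eHomWhiskerRight V (adj.unit.app X) (G.obj (F.obj Y)) =
      eHomWhiskerLeft V X (adj.unit.app Y)
  counit_naturality (X Y : D) :
    right.map X Y ≫ left.map (G.obj X) (G.obj Y) ≫
        eHomWhiskerLeft V (F.obj (G.obj X)) (adj.counit.app Y) =
      eHomWhiskerRight V (adj.counit.app X) Y

section

variable {M : Type u₁} [Category.{v₁} M] [EnrichedOrdinaryCategory V M]
  {I : Type w} {Φ : Filter I} [∀ J : Set I, HasProductsOfShape J V]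

variable (Φ) in
/-- The filtered diagram `J ↦ ∏_{i ∈ J} Map(X i, Y i)`, whose transition morphisms are the
projections. -/
def mapDiagram (X Y : I → M) : (Members Φ)ᵒᵖ ⥤ V where
  obj J := ∏ᶜ fun i : J.unop.1 => (X i ⟶[V] Y i)
  map {J K} h := Pi.lift fun i : K.unop.1 =>
    Pi.π (fun i : J.unop.1 => (X i ⟶[V] Y i)) ⟨i.1, leOfHom h.unop i.2⟩

/-- An enrichment of `∏_Φ M` is induced by that of `M` if its mapping objects are the
filtered colimits `Map(X, Y) = colim_{J ∈ Φ} ∏_{i ∈ J} Map(X i, Y i)`, with the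
identities, the composition and the identification of morphisms coming from those of `M`. -/
structure IsInducedEnrichment [HasInitial M] [HasTerminal M] [HasBinaryProducts M]
    [EnrichedOrdinaryCategory V (FilterProduct M Φ)]
    (ι : ∀ X Y : I → M, mapDiagram V Φ X Y ⟶
      (Functor.const _).obj ((proj M Φ).obj X ⟶[V] (proj M Φ).obj Y)) : Prop where
  isColimit (X Y : I → M) : Nonempty (IsColimit (Cocone.mk _ (ι X Y)))
  homEquiv_eq {X Y : I → M} {J : Members Φ} (f : ∀ i : J.1, X i ⟶ Y i) :
    eHomEquiv V (germ f) = Pi.lift (fun i : J.1 => eHomEquiv V (f i)) ≫ (ι X Y).app (op J)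
  id_eq (X : I → M) :
    eId V ((proj M Φ).obj X) =
      Pi.lift (fun i : (⊤ : Members Φ).1 => eId V (X i)) ≫ (ι X X).app (op ⊤)
  comp_eq (X Y Z : I → M) (J : Members Φ) :
    ((ι X Y).app (op J) ⊗ₘ (ι Y Z).app (op J)) ≫ eComp V _ _ _ =
      Pi.lift (fun i : J.1 => (Pi.π _ i ⊗ₘ Pi.π _ i) ≫ eComp V (X i) (Y i) (Z i)) ≫
        (ι X Z).app (op J)

end

end Enriched

end FilterModel

end

open FilterModel

open FilterModel

noncomputable section

namespace FilterModel

/-! ### Morphisms of the filter product as germs of families along the filter. -/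

section Germs

variable {M : Type u} [Category.{v} M] {I : Type w} {Φ : Filter I}
  [HasInitial M] [HasTerminal M] [HasBinaryProducts M]

/-! The object `X × U_J` is `X i` at the indices in `J`, because `U_J` is terminal there, and
initial elsewhere, because an object mapping to a strict initial object is initial. Hence a morphism
`X × U_J ⟶ Y` is the same as a family `X i ⟶ Y i`, `i ∈ J`, and a morphism of the filter product is
a germ of such families along `Φ` (`germ_eq_iff`). After choosing a representative of every
morphism, `HasComponent` expresses "the component of `φ` at `i` is `f`"; components exist
eventually, are unique, and are eventually compatible with composition (`HasComponent.comp`).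

The rest of the model-categorical part is a transfer principle. A condition on finitely many
morphisms of the filter product unfolds to a condition that holds at eventually all indices, and
finitely many such conditions hold together on one member of the filter. Conversely, if a problem
for a single morphism is eventually solvable, choosing solutions index by index gives a morphism of
the filter product (`HasComponent.exists_hom`). A morphism lies in one of the three classes if and
only if its components eventually do (`productProperty_iff`). The axioms of a model category concern
only finite diagrams, so they pass from the factors to the filter product. A functor or an
adjunction acts by acting on components, and the conditions on derived units and counits are checked
at each index.

For the enrichment, `Map(X, Y)` is the filtered colimit of the products over the members of `Φ`. A
compact object maps to this colimit exactly by germs of families (`exists_lift_fromProd_eq`,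
`lift_fromProd_eq_iff`), so `homEquivOfCompact` transports identifications of morphisms from the
factors; it is used for the unit and for tensors and cotensors by compact objects. Since `⊗`
commutes with filtered colimits in each variable, composition is defined and its laws are checked at
one stage `J`. Finally, the pullback-hom of two morphisms is a filtered colimit of products of the
pullback-homs of their components, because filtered colimits are exact (`pullback_lift_mem`);
(trivial) fibrations are stable under both operations. -/

lemma isIso_prod_fst_apply {X : I → M} {J : Members Φ} {i : I} (hi : i ∈ J.1) :
    IsIso ((prod.fst : X ⨯ (subterminals M Φ).obj J ⟶ X) i) := by
  let U := (subterminals M Φ).obj J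
  -- The product chosen in `∏_I M` need not be the componentwise one, so it is compared with the
  -- componentwise cone through the canonical isomorphism `e`.
  let c : BinaryFan X U := BinaryFan.mk (P := fun i => X i ⨯ U i)
    (fun i => prod.fst) (fun i => prod.snd)
  have hc : IsLimit c := BinaryFan.IsLimit.mk _ (fun f g i => prod.lift (f i) (g i))
    (fun f g => funext fun i => prod.lift_fst _ _)
    (fun f g => funext fun i => prod.lift_snd _ _)
    (fun f g m hf hg => funext fun i => by
      refine Limits.prod.hom_ext ?_ ?_
      · exact (congrFun hf i).trans (prod.lift_fst _ _).symm
      · exact (congrFun hg i).trans (prod.lift_snd _ _).symm)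
  let e := (prodIsProd X U).conePointUniqueUpToIso hc
  have h : e.hom ≫ c.fst = prod.fst :=
    (prodIsProd X U).conePointUniqueUpToIso_hom_comp hc ⟨WalkingPair.left⟩
  have h₁ : e.hom i ≫ e.inv i = 𝟙 _ := congrFun e.hom_inv_id i
  have h₂ : e.inv i ≫ e.hom i = 𝟙 _ := congrFun e.inv_hom_id i
  have : IsIso (e.hom i) := ⟨e.inv i, h₁, h₂⟩
  have hU : IsTerminal (U i) := terminalIsTerminal.ofIso (eqToIso (if_pos hi).symm)
  have : IsIso (prod.fst : X i ⨯ U i ⟶ X i) :=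
    ⟨prod.lift (𝟙 _) (hU.from _), Limits.prod.hom_ext
      (by rw [Category.assoc, prod.lift_fst, Category.comp_id, Category.id_comp])
      (hU.hom_ext _ _), prod.lift_fst _ _⟩
  have h' : e.hom i ≫ (prod.fst : X i ⨯ U i ⟶ X i) = _ := congrFun h i
  rw [← h']
  infer_instance

lemma ofFamily_apply {X Y : I → M} {J : Members Φ} (f : ∀ i : J.1, X i ⟶ Y i) {i : I}
    (hi : i ∈ J.1) :
    ofFamily f i = (prod.fst : X ⨯ (subterminals M Φ).obj J ⟶ X) i ≫ f ⟨i, hi⟩ :=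
  dif_pos hi

/-- Over `J` the first projection is invertible and can be cancelled. Together with
`ofFamily_surjective` this identifies morphisms `X × U_J ⟶ Y` with families over `J`. -/
lemma ofFamily_injective {X Y : I → M} {J : Members Φ} :
    Function.Injective (ofFamily : (∀ i : J.1, X i ⟶ Y i) → _) := fun f g h => by
  funext ⟨i, hi⟩
  have := isIso_prod_fst_apply (X := X) hi
  have h' := congrFun h i
  rwa [ofFamily_apply _ hi, ofFamily_apply _ hi, cancel_epi] at h'

variable [HasStrictInitialObjects M]

/-- Away from `J`, the product with the subterminal object attached to `J` is initial. -/
def isInitialProdApply (X : I → M) {J : Members Φ} {i : I} (hi : i ∉ J.1) :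
    IsInitial ((X ⨯ (subterminals M Φ).obj J : I → M) i) :=
  IsInitial.ofStrict ((prod.snd : X ⨯ (subterminals M Φ).obj J ⟶ _) i)
    (initialIsInitial.ofIso (eqToIso (if_neg hi).symm))

/-- Strictness enters here: at the indices outside `J` the source is initial, so nothing has to be
checked there. -/
lemma hom_prod_ext {X Y : I → M} {J : Members Φ} {f g : X ⨯ (subterminals M Φ).obj J ⟶ Y}
    (h : ∀ i ∈ J.1, f i = g i) : f = g := by
  funext i
  by_cases hi : i ∈ J.1
  · exact h i hi
  · exact (isInitialProdApply X hi).hom_ext _ _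

lemma res_ofFamily {X Y : I → M} {J K : Members Φ} (h : K ≤ J) (f : ∀ i : J.1, X i ⟶ Y i) :
    FilterQuotient.res h (ofFamily f) = ofFamily fun i : K.1 => f ⟨i.1, h i.2⟩ := by
  refine hom_prod_ext fun i hi => ?_
  rw [ofFamily_apply _ hi]
  refine (congrArg (_ ≫ ·) (ofFamily_apply f (h hi))).trans ?_
  rw [← Category.assoc]
  refine congrArg (· ≫ _) ?_
  refine (congrFun (prod.map_fst (𝟙 X) ((subterminals M Φ).map (homOfLE h))) i).trans ?_
  exact Category.comp_id _

lemma graph_ofFamily_comp {X Y Z : I → M} {J : Members Φ} (f : ∀ i : J.1, X i ⟶ Y i)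
    (g : ∀ i : J.1, Y i ⟶ Z i) :
    FilterQuotient.graph (ofFamily f) ≫ ofFamily g = ofFamily fun i => f i ≫ g i := by
  refine hom_prod_ext fun i hi => ?_
  refine (congrArg (_ ≫ ·) (ofFamily_apply g hi)).trans ?_
  rw [← Category.assoc, ofFamily_apply _ hi, ← Category.assoc]
  refine congrArg (· ≫ _) ?_
  exact (congrFun (prod.lift_fst (ofFamily f) prod.snd) i).trans (ofFamily_apply f hi)

lemma ofFamily_surjective {X Y : I → M} {J : Members Φ} :
    Function.Surjective (ofFamily : (∀ i : J.1, X i ⟶ Y i) → _) := fun g => by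
  refine ⟨fun i => @inv _ _ _ _ _ (isIso_prod_fst_apply (X := X) i.2) ≫ g i,
    hom_prod_ext fun i hi => ?_⟩
  have := isIso_prod_fst_apply (X := X) hi
  rw [ofFamily_apply _ hi]
  simp

/-- Agreement after restriction to a smaller member is agreement at eventually all indices. The
quantifiers over `hJ` and `hK` avoid naming a common member on which both families are defined. -/
lemma germ_eq_iff {X Y : I → M} {J K : Members Φ} {f : ∀ i : J.1, X i ⟶ Y i}
    {g : ∀ i : K.1, X i ⟶ Y i} :
    germ f = germ g ↔ ∀ᶠ i in Φ, ∀ hJ hK, f ⟨i, hJ⟩ = g ⟨i, hK⟩ := by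
  constructor
  · intro h
    obtain ⟨L, hJ, hK, h⟩ := Quotient.exact h
    dsimp only at hJ hK h
    rw [res_ofFamily, res_ofFamily] at h
    filter_upwards [L.2] with i hi _ _
    exact congrFun (ofFamily_injective h) ⟨i, hi⟩
  · intro h
    let L : Members Φ := ⟨_, Filter.inter_mem (Filter.inter_mem J.2 K.2) h⟩
    have hJ : L ≤ J := fun i hi => hi.1.1
    have hK : L ≤ K := fun i hi => hi.1.2
    refine FilterQuotient.Hom.mk_eq hJ hK ?_
    rw [res_ofFamily, res_ofFamily]
    congr 1
    funext i
    exact i.2.2 _ _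

lemma germ_restrict {X Y : I → M} {J K : Members Φ} (h : K ≤ J) (f : ∀ i : J.1, X i ⟶ Y i) :
    germ (fun i : K.1 => f ⟨i.1, h i.2⟩) = germ f :=
  germ_eq_iff.2 (.of_forall fun _ _ _ => rfl)

lemma germ_comp {X Y Z : I → M} {J : Members Φ} (f : ∀ i : J.1, X i ⟶ Y i)
    (g : ∀ i : J.1, Y i ⟶ Z i) : germ f ≫ germ g = germ fun i => f i ≫ g i :=
  (FilterQuotient.Hom.mk_comp_mk _ _).trans
    (congrArg FilterQuotient.Hom.mk (graph_ofFamily_comp f g))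

lemma proj_map_eq_germ {X Y : I → M} (f : X ⟶ Y) (J : Members Φ) :
    (proj M Φ).map f = germ fun i : J.1 => f i := by
  refine Eq.trans ?_ (germ_restrict (le_top : J ≤ ⊤) fun i => f i).symm
  refine congrArg FilterQuotient.homMk (hom_prod_ext fun i hi => ?_)
  exact (ofFamily_apply (fun i : (⊤ : Members Φ).1 => f i) hi).symm

lemma germ_id (X : I → M) (J : Members Φ) :
    germ (fun i : J.1 => 𝟙 (X i)) = 𝟙 ((proj M Φ).obj X) :=
  (proj_map_eq_germ (𝟙 X) J).symm.trans ((proj M Φ).map_id X)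

lemma exists_germ_eq {X Y : FilterProduct M Φ} (φ : X ⟶ Y) :
    ∃ J : Members Φ, ∀ K ≤ J, ∃ f : ∀ i : K.1, X.as i ⟶ Y.as i, germ f = φ := by
  obtain ⟨J, hJ⟩ := FilterQuotient.Hom.exists_mk φ
  refine ⟨J, fun K hK => ?_⟩
  obtain ⟨g, hg⟩ := hJ K hK
  obtain ⟨f, rfl⟩ := ofFamily_surjective g
  exact ⟨f, hg⟩

/-! ### Components of morphisms of filter products -/

variable {X Y Z : FilterProduct M Φ}

/-- A member of the filter over which a morphism of the filter product is represented. -/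
def support (φ : X ⟶ Y) : Members Φ := (exists_germ_eq φ).choose

/-- A family of morphisms that represents a morphism of the filter product. -/
def component (φ : X ⟶ Y) : ∀ i : (support φ).1, X.as i ⟶ Y.as i :=
  ((exists_germ_eq φ).choose_spec _ le_rfl).choose

lemma germ_component (φ : X ⟶ Y) : germ (component φ) = φ :=
  ((exists_germ_eq φ).choose_spec _ le_rfl).choose_spec

/-- The chosen representative of `φ` is defined at the index `i`, where its value is `f`. -/
def HasComponent (φ : X ⟶ Y) (i : I) (f : X.as i ⟶ Y.as i) : Prop :=
  ∃ hi : i ∈ (support φ).1, component φ ⟨i, hi⟩ = f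

namespace HasComponent

lemma unique {φ : X ⟶ Y} {i : I} {f g : X.as i ⟶ Y.as i} (hf : HasComponent φ i f)
    (hg : HasComponent φ i g) : f = g := hf.2.symm.trans hg.2

lemma eventually_exists (φ : X ⟶ Y) : ∀ᶠ i in Φ, ∃ f, HasComponent φ i f := by
  filter_upwards [(support φ).2] with i hi using ⟨_, hi, rfl⟩

lemma of_germ {X Y : I → M} {J : Members Φ} (f : ∀ i : J.1, X i ⟶ Y i) :
    ∀ᶠ i in Φ, ∀ hi, HasComponent (germ f) i (f ⟨i, hi⟩) := by
  filter_upwards [(support (germ f)).2, germ_eq_iff.1 (germ_component (germ f))]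
    with i hi h hi' using ⟨hi, h hi hi'⟩

lemma of_proj_map {X Y : I → M} (f : X ⟶ Y) :
    ∀ᶠ i in Φ, HasComponent ((proj M Φ).map f) i (f i) := by
  rw [proj_map_eq_germ f ⊤]
  filter_upwards [of_germ (Φ := Φ) fun i : (⊤ : Members Φ).1 => f i] with i hi using hi trivial

lemma of_id (X : FilterProduct M Φ) : ∀ᶠ i in Φ, HasComponent (𝟙 X) i (𝟙 (X.as i)) := by
  have := of_proj_map (Φ := Φ) (𝟙 X.as)
  rwa [(proj M Φ).map_id] at this

/-- The representative chosen for `φ ≫ ψ` is unrelated to those chosen for `φ` and `ψ`, but both it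
and the composite family have germ `φ ≫ ψ`, so they agree eventually. -/
lemma comp (φ : X ⟶ Y) (ψ : Y ⟶ Z) : ∀ᶠ i in Φ, ∀ f g, HasComponent φ i f →
    HasComponent ψ i g → HasComponent (φ ≫ ψ) i (f ≫ g) := by
  let J := support φ ⊓ support ψ
  have h : germ (fun i : J.1 => component φ ⟨i.1, i.2.1⟩ ≫ component ψ ⟨i.1, i.2.2⟩) =
      φ ≫ ψ := by
    rw [← germ_comp, germ_restrict (inf_le_left : J ≤ support φ),
      germ_restrict (inf_le_right : J ≤ support ψ), germ_component, germ_component]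
    rfl
  rw [← h]
  filter_upwards [of_germ (fun i : J.1 => component φ ⟨i.1, i.2.1⟩ ≫ component ψ ⟨i.1, i.2.2⟩)]
  rintro i h _ _ ⟨h₁, rfl⟩ ⟨h₂, rfl⟩
  exact h ⟨h₁, h₂⟩

lemma ext {φ ψ : X ⟶ Y} (h : ∀ᶠ i in Φ, ∃ f, HasComponent φ i f ∧ HasComponent ψ i f) :
    φ = ψ := by
  refine (germ_component φ).symm.trans (Eq.trans (germ_eq_iff.2 ?_) (germ_component ψ))
  filter_upwards [h]
  rintro i ⟨f, ⟨_, rfl⟩, _, h⟩ _ _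
  exact h.symm

/-- This is the device that constructs morphisms: solutions are chosen over the set of solvable
indices, which is a member of `Φ`, and their germ is taken. Its own representative agrees with the
chosen solutions eventually. -/
lemma exists_hom {p : ∀ i, (X.as i ⟶ Y.as i) → Prop} (h : ∀ᶠ i in Φ, ∃ f, p i f) :
    ∃ φ : X ⟶ Y, ∀ᶠ i in Φ, ∃ f, HasComponent φ i f ∧ p i f := by
  let J : Members Φ := ⟨_, h⟩
  refine ⟨germ (J := J) fun i => i.2.choose, ?_⟩
  filter_upwards [h, of_germ (J := J) fun i => i.2.choose] with i hi h
  exact ⟨_, h hi, hi.choose_spec⟩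

end HasComponent

/-- At an index of `J`, the graph of a family is isomorphic, as an arrow, to the member of the
family. At the other indices it is an isomorphism between initial objects, so it lies in `S` for
free. -/
lemma productProperty_iff {S : MorphismProperty M} [S.ContainsIdentities] [S.RespectsIso]
    (φ : X ⟶ Y) :
    productProperty M Φ S φ ↔ ∀ᶠ i in Φ, ∃ f, HasComponent φ i f ∧ S f := by
  have key {J : Members Φ} (f : ∀ i : J.1, X.as i ⟶ Y.as i) {i : I} (hi : i ∈ J.1) :
      S (FilterQuotient.graph (ofFamily f) i) ↔ S (f ⟨i, hi⟩) := by
    have h₁ := isIso_prod_fst_apply (X := X.as) hi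
    have h₂ := isIso_prod_fst_apply (X := Y.as) hi
    refine S.arrow_mk_iso_iff (Arrow.isoMk (@asIso _ _ _ _ _ h₁) (@asIso _ _ _ _ _ h₂) ?_)
    have h := congrFun (prod.lift_fst (ofFamily f) prod.snd) i
    exact ((h.trans (ofFamily_apply f hi))).symm
  constructor
  · rintro ⟨J, g, rfl, hg⟩
    obtain ⟨f, rfl⟩ := ofFamily_surjective g
    filter_upwards [J.2, HasComponent.of_germ f] with i hi h
    exact ⟨_, h hi, (key f hi).1 (hg i)⟩
  · intro h
    -- The graph must lie in `S` at every index, so the representative is restricted to exactly the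
    -- indices where its component does.
    let J : Members Φ := ⟨_, h⟩
    have hJ : J ≤ support φ := fun i hi => hi.choose_spec.1.1
    refine ⟨J, ofFamily fun i => component φ ⟨i.1, hJ i.2⟩, ?_, fun i => ?_⟩
    · exact (germ_component φ).symm.trans (germ_restrict hJ _).symm
    · by_cases hi : i ∈ J.1
      · refine (key _ hi).2 ?_
        obtain ⟨f, ⟨_, rfl⟩, hf⟩ := hi
        exact hf
      · have h₁ := isInitialProdApply X.as hi
        have h₂ := isInitialProdApply Y.as hi
        have : IsIso (FilterQuotient.graph (ofFamily fun i : J.1 => component φ ⟨i.1, hJ i.2⟩) i) :=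
          h₂.isIso_to _
        exact MorphismProperty.of_isIso _ _

end Germs

/-! ### Transfer of finite diagrams and of the model category axioms. -/

section Model

variable {M : Type u} [Category.{v} M] {I : Type w} {Φ : Filter I}
  [HasInitial M] [HasTerminal M] [HasBinaryProducts M] [HasStrictInitialObjects M]

namespace HasComponent

variable {W X Y Z : FilterProduct M Φ}

lemma comp_eq {φ : X ⟶ Y} {ψ : Y ⟶ Z} {χ : X ⟶ Z} (w : φ ≫ ψ = χ) :
    ∀ᶠ i in Φ, ∀ f g h, HasComponent φ i f → HasComponent ψ i g → HasComponent χ i h →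
      f ≫ g = h := by
  subst w
  filter_upwards [comp φ ψ] with i hi f g h hf hg hh using (hi f g hf hg).unique hh

lemma comp_eq_comp {φ : X ⟶ Y} {ψ : Y ⟶ Z} {φ' : X ⟶ W} {ψ' : W ⟶ Z} (w : φ ≫ ψ = φ' ≫ ψ') :
    ∀ᶠ i in Φ, ∀ f g f' g', HasComponent φ i f → HasComponent ψ i g → HasComponent φ' i f' →
      HasComponent ψ' i g' → f ≫ g = f' ≫ g' := by
  filter_upwards [comp_eq w, comp φ' ψ'] with i h h' f g f' g' hf hg hf' hg'
    using h f g _ hf hg (h' f' g' hf' hg')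

lemma comp_eq_of {φ : X ⟶ Y} {ψ : Y ⟶ Z} {χ : X ⟶ Z}
    (w : ∀ᶠ i in Φ, ∃ f g h, HasComponent φ i f ∧ HasComponent ψ i g ∧ HasComponent χ i h ∧
      f ≫ g = h) : φ ≫ ψ = χ := by
  refine ext ?_
  filter_upwards [comp φ ψ, w]
  rintro i h ⟨f, g, _, hf, hg, hh, rfl⟩
  exact ⟨_, h f g hf hg, hh⟩

lemma comp_eq_comp_of {φ : X ⟶ Y} {ψ : Y ⟶ Z} {φ' : X ⟶ W} {ψ' : W ⟶ Z}
    (w : ∀ᶠ i in Φ, ∃ f g f' g', HasComponent φ i f ∧ HasComponent ψ i g ∧ HasComponent φ' i f' ∧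
      HasComponent ψ' i g' ∧ f ≫ g = f' ≫ g') : φ ≫ ψ = φ' ≫ ψ' := by
  refine comp_eq_of ?_
  filter_upwards [comp φ' ψ', w]
  rintro i h ⟨f, g, f', g', hf, hg, hf', hg', e⟩
  exact ⟨f, g, _, hf, hg, h f' g' hf' hg', e⟩

end HasComponent

open HasComponent

/-! ### Finite limits and colimits in filter products -/

variable (Φ) in
/-- An object that is componentwise terminal is terminal in the filter product. -/
def isTerminalMk {X : I → M} (hX : ∀ i, IsTerminal (X i)) :
    IsTerminal (⟨X⟩ : FilterProduct M Φ) :=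
  IsTerminal.ofUniqueHom (fun Y => (proj M Φ).map (X := Y.as) fun i => (hX i).from _)
    fun Y f => ext (by
      filter_upwards [eventually_exists f, of_proj_map (Φ := Φ) fun i => (hX i).from (Y.as i)]
      rintro i ⟨g, hg⟩ h
      exact ⟨g, hg, (hX i).hom_ext ((hX i).from (Y.as i)) g ▸ h⟩)

variable (Φ) in
/-- An object that is componentwise initial is initial in the filter product. -/
def isInitialMk {X : I → M} (hX : ∀ i, IsInitial (X i)) :
    IsInitial (⟨X⟩ : FilterProduct M Φ) :=
  IsInitial.ofUniqueHom (fun Y => (proj M Φ).map (Y := Y.as) fun i => (hX i).to _)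
    fun Y f => ext (by
      filter_upwards [eventually_exists f, of_proj_map (Φ := Φ) fun i => (hX i).to (Y.as i)]
      rintro i ⟨g, hg⟩ h
      exact ⟨g, hg, (hX i).hom_ext ((hX i).to (Y.as i)) g ▸ h⟩)

variable {P X Y Z : FilterProduct M Φ}

/-- The legs of a competing cone have components eventually, which form cones over the component
squares. The lifts at the indices assemble to a morphism by `exists_hom`, and uniqueness holds index
by index. -/
lemma isPullback_of_eventually {p : P ⟶ X} {q : P ⟶ Y} {f : X ⟶ Z} {g : Y ⟶ Z}
    (h : ∀ᶠ i in Φ, ∃ p' q' f' g', HasComponent p i p' ∧ HasComponent q i q' ∧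
      HasComponent f i f' ∧ HasComponent g i g' ∧ IsPullback p' q' f' g') :
    IsPullback p q f g := by
  have ex (s : PullbackCone f g) : ∃ l : s.pt ⟶ P, l ≫ p = s.fst ∧ l ≫ q = s.snd := by
    obtain ⟨l, hl⟩ := exists_hom (X := s.pt) (Y := P) (Φ := Φ) (p := fun i l => ∃ p' q' a b,
        HasComponent p i p' ∧ HasComponent q i q' ∧ HasComponent s.fst i a ∧
        HasComponent s.snd i b ∧ l ≫ p' = a ∧ l ≫ q' = b) (by
      filter_upwards [h, eventually_exists s.fst, eventually_exists s.snd,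
        comp_eq_comp s.condition]
      rintro i ⟨p', q', f', g', hp, hq, hf, hg, H⟩ ⟨a, ha⟩ ⟨b, hb⟩ e
      exact ⟨H.lift a b (e _ _ _ _ ha hf hb hg), p', q', a, b, hp, hq, ha, hb, by simp, by simp⟩)
    refine ⟨l, comp_eq_of ?_, comp_eq_of ?_⟩ <;> filter_upwards [hl] <;>
      rintro i ⟨l', hl', p', q', a, b, hp, hq, ha, hb, e₁, e₂⟩
    · exact ⟨_, _, _, hl', hp, ha, e₁⟩
    · exact ⟨_, _, _, hl', hq, hb, e₂⟩
  refine ⟨⟨comp_eq_comp_of ?_⟩, ⟨PullbackCone.IsLimit.mk _ (fun s => (ex s).choose)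
    (fun s => (ex s).choose_spec.1) (fun s => (ex s).choose_spec.2) fun s m h₁ h₂ => ext ?_⟩⟩
  · filter_upwards [h]
    rintro i ⟨p', q', f', g', hp, hq, hf, hg, H⟩
    exact ⟨_, _, _, _, hp, hf, hq, hg, H.w⟩
  · filter_upwards [h, comp_eq_comp (h₁.trans (ex s).choose_spec.1.symm),
      comp_eq_comp (h₂.trans (ex s).choose_spec.2.symm), eventually_exists m,
      eventually_exists (ex s).choose]
    rintro i ⟨p', q', f', g', hp, hq, hf, hg, H⟩ e₁ e₂ ⟨a, ha⟩ ⟨b, hb⟩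
    obtain rfl : a = b := H.hom_ext (e₁ _ _ _ _ ha hp hb hp) (e₂ _ _ _ _ ha hq hb hq)
    exact ⟨a, ha, hb⟩

lemma isPushout_of_eventually {p : X ⟶ P} {q : Y ⟶ P} {f : Z ⟶ X} {g : Z ⟶ Y}
    (h : ∀ᶠ i in Φ, ∃ p' q' f' g', HasComponent p i p' ∧ HasComponent q i q' ∧
      HasComponent f i f' ∧ HasComponent g i g' ∧ IsPushout f' g' p' q') :
    IsPushout f g p q := by
  have ex (s : PushoutCocone f g) : ∃ l : P ⟶ s.pt, p ≫ l = s.inl ∧ q ≫ l = s.inr := by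
    obtain ⟨l, hl⟩ := exists_hom (X := P) (Y := s.pt) (Φ := Φ) (p := fun i l => ∃ p' q' a b,
        HasComponent p i p' ∧ HasComponent q i q' ∧ HasComponent s.inl i a ∧
        HasComponent s.inr i b ∧ p' ≫ l = a ∧ q' ≫ l = b) (by
      filter_upwards [h, eventually_exists s.inl, eventually_exists s.inr,
        comp_eq_comp s.condition]
      rintro i ⟨p', q', f', g', hp, hq, hf, hg, H⟩ ⟨a, ha⟩ ⟨b, hb⟩ e
      exact ⟨H.desc a b (e _ _ _ _ hf ha hg hb), p', q', a, b, hp, hq, ha, hb, by simp, by simp⟩)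
    refine ⟨l, comp_eq_of ?_, comp_eq_of ?_⟩ <;> filter_upwards [hl] <;>
      rintro i ⟨l', hl', p', q', a, b, hp, hq, ha, hb, e₁, e₂⟩
    · exact ⟨_, _, _, hp, hl', ha, e₁⟩
    · exact ⟨_, _, _, hq, hl', hb, e₂⟩
  refine ⟨⟨comp_eq_comp_of ?_⟩, ⟨PushoutCocone.IsColimit.mk _ (fun s => (ex s).choose)
    (fun s => (ex s).choose_spec.1) (fun s => (ex s).choose_spec.2) fun s m h₁ h₂ => ext ?_⟩⟩
  · filter_upwards [h]
    rintro i ⟨p', q', f', g', hp, hq, hf, hg, H⟩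
    exact ⟨_, _, _, _, hf, hp, hg, hq, H.w⟩
  · filter_upwards [h, comp_eq_comp (h₁.trans (ex s).choose_spec.1.symm),
      comp_eq_comp (h₂.trans (ex s).choose_spec.2.symm), eventually_exists m,
      eventually_exists (ex s).choose]
    rintro i ⟨p', q', f', g', hp, hq, hf, hg, H⟩ e₁ e₂ ⟨a, ha⟩ ⟨b, hb⟩
    obtain rfl : a = b := H.hom_ext (e₁ _ _ _ _ hp ha hp hb) (e₂ _ _ _ _ hq ha hq hb)
    exact ⟨a, ha, hb⟩

instance [HasPullbacks M] : HasPullbacks (FilterProduct M Φ) := by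
  refine @hasPullbacks_of_hasLimit_cospan _ _ fun {X Y Z f g} => ?_
  -- An object of the filter product needs a value at every index, so the pullback objects are fixed
  -- before any morphism is chosen. Where `f` or `g` has no component, `X.as i` is an arbitrary
  -- value.
  have (i : I) : ∃ Q : M, ∀ f' g', HasComponent f i f' → HasComponent g i g' →
      ∃ (p : Q ⟶ X.as i) (q : Q ⟶ Y.as i), IsPullback p q f' g' := by
    by_cases hi : ∃ f' g', HasComponent f i f' ∧ HasComponent g i g'
    · obtain ⟨f', g', hf, hg⟩ := hi
      refine ⟨pullback f' g', fun f'' g'' hf' hg' => ?_⟩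
      obtain rfl := hf.unique hf'
      obtain rfl := hg.unique hg'
      exact ⟨_, _, .of_hasPullback _ _⟩
    · exact ⟨X.as i, fun f' g' hf hg => (hi ⟨f', g', hf, hg⟩).elim⟩
  choose Q hQ using this
  obtain ⟨p, hp⟩ := exists_hom (X := ⟨Q⟩) (Y := X) (Φ := Φ) (p := fun i p => ∃ q f' g',
      HasComponent f i f' ∧ HasComponent g i g' ∧ IsPullback p q f' g') (by
    filter_upwards [eventually_exists f, eventually_exists g]
    rintro i ⟨f', hf⟩ ⟨g', hg⟩
    obtain ⟨p, q, H⟩ := hQ i f' g' hf hg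
    exact ⟨p, q, f', g', hf, hg, H⟩)
  -- The projections are produced one after the other: `q` is chosen relative to the component of
  -- the already fixed `p`, so that both together eventually form a pullback square.
  obtain ⟨q, hq⟩ := exists_hom (X := ⟨Q⟩) (Y := Y) (Φ := Φ) (p := fun i q => ∃ p' f' g',
      HasComponent p i p' ∧ HasComponent f i f' ∧ HasComponent g i g' ∧ IsPullback p' q f' g') (by
    filter_upwards [hp]
    rintro i ⟨p', hp, q, f', g', hf, hg, H⟩
    exact ⟨q, p', f', g', hp, hf, hg, H⟩)
  have : IsPullback p q f g := isPullback_of_eventually (by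
    filter_upwards [hq]
    rintro i ⟨q', hq, p', f', g', hp, hf, hg, H⟩
    exact ⟨p', q', f', g', hp, hq, hf, hg, H⟩)
  exact this.hasPullback

instance [HasPushouts M] : HasPushouts (FilterProduct M Φ) := by
  refine @hasPushouts_of_hasColimit_span _ _ fun {Z X Y f g} => ?_
  have (i : I) : ∃ Q : M, ∀ f' g', HasComponent f i f' → HasComponent g i g' →
      ∃ (p : X.as i ⟶ Q) (q : Y.as i ⟶ Q), IsPushout f' g' p q := by
    by_cases hi : ∃ f' g', HasComponent f i f' ∧ HasComponent g i g'
    · obtain ⟨f', g', hf, hg⟩ := hi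
      refine ⟨pushout f' g', fun f'' g'' hf' hg' => ?_⟩
      obtain rfl := hf.unique hf'
      obtain rfl := hg.unique hg'
      exact ⟨_, _, .of_hasPushout _ _⟩
    · exact ⟨X.as i, fun f' g' hf hg => (hi ⟨f', g', hf, hg⟩).elim⟩
  choose Q hQ using this
  obtain ⟨p, hp⟩ := exists_hom (X := X) (Y := ⟨Q⟩) (Φ := Φ) (p := fun i p => ∃ q f' g',
      HasComponent f i f' ∧ HasComponent g i g' ∧ IsPushout f' g' p q) (by
    filter_upwards [eventually_exists f, eventually_exists g]
    rintro i ⟨f', hf⟩ ⟨g', hg⟩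
    obtain ⟨p, q, H⟩ := hQ i f' g' hf hg
    exact ⟨p, q, f', g', hf, hg, H⟩)
  obtain ⟨q, hq⟩ := exists_hom (X := Y) (Y := ⟨Q⟩) (Φ := Φ) (p := fun i q => ∃ p' f' g',
      HasComponent p i p' ∧ HasComponent f i f' ∧ HasComponent g i g' ∧ IsPushout f' g' p' q) (by
    filter_upwards [hp]
    rintro i ⟨p', hp, q, f', g', hf, hg, H⟩
    exact ⟨q, p', f', g', hp, hf, hg, H⟩)
  have : IsPushout f g p q := isPushout_of_eventually (by
    filter_upwards [hq]
    rintro i ⟨q', hq, p', f', g', hp, hf, hg, H⟩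
    exact ⟨p', q', f', g', hp, hq, hf, hg, H⟩)
  exact this.hasPushout

instance [HasPullbacks M] : HasFiniteLimits (FilterProduct M Φ) :=
  have : HasTerminal (FilterProduct M Φ) :=
    (isTerminalMk Φ (M := M) fun _ => terminalIsTerminal).hasTerminal
  hasFiniteLimits_of_hasTerminal_and_pullbacks

instance [HasPushouts M] : HasFiniteColimits (FilterProduct M Φ) :=
  have : HasInitial (FilterProduct M Φ) :=
    (isInitialMk Φ (M := M) fun _ => initialIsInitial).hasInitial
  hasFiniteColimits_of_hasInitial_and_pushouts

/-! ### Classes of morphisms of filter products -/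

lemma productProperty_inf (S T : MorphismProperty M) [S.ContainsIdentities] [S.RespectsIso]
    [T.ContainsIdentities] [T.RespectsIso] :
    productProperty M Φ S ⊓ productProperty M Φ T = productProperty M Φ (S ⊓ T) := by
  ext X Y f
  refine (and_congr (productProperty_iff f) (productProperty_iff f)).trans ?_
  rw [productProperty_iff, ← Filter.eventually_and]
  refine Filter.eventually_congr (.of_forall fun i => ⟨?_, ?_⟩)
  · rintro ⟨⟨f', hf, h⟩, f'', hf', h'⟩
    obtain rfl := hf.unique hf'
    exact ⟨f', hf, h, h'⟩
  · rintro ⟨f', hf, h, h'⟩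
    exact ⟨⟨f', hf, h⟩, f', hf, h'⟩

/-- A retract diagram consists of finitely many morphisms and equations, so it is a retract diagram
of components at eventually all indices. -/
lemma productProperty_isStableUnderRetracts (S : MorphismProperty M) [S.ContainsIdentities]
    [S.IsStableUnderRetracts] :
    (productProperty M Φ S).IsStableUnderRetracts where
  of_retract {X Y Z W f g} h hg := by
    rw [productProperty_iff] at hg ⊢
    filter_upwards [hg, eventually_exists f, eventually_exists h.i.left,
      eventually_exists h.i.right, eventually_exists h.r.left, eventually_exists h.r.right,
      of_id X, of_id Y, comp_eq_comp h.i_w, comp_eq_comp h.r_w,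
      comp_eq h.retract_left, comp_eq h.retract_right]
    rintro i ⟨g', hg, hS⟩ ⟨f', hf⟩ ⟨a, ha⟩ ⟨b, hb⟩ ⟨c, hc⟩ ⟨d, hd⟩ hX hY e₁ e₂ e₃ e₄
    refine ⟨f', hf, S.of_retract (g := g') ?_ hS⟩
    exact
      { i := Arrow.homMk a b (e₁ _ _ _ _ ha hg hf hb)
        r := Arrow.homMk c d (e₂ _ _ _ _ hc hf hg hd)
        retract := Arrow.hom_ext _ _ (e₃ _ _ _ ha hc hX) (e₄ _ _ _ hb hd hY) }

lemma productProperty_hasTwoOutOfThree (S : MorphismProperty M) [S.ContainsIdentities]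
    [S.RespectsIso] [S.HasTwoOutOfThreeProperty] :
    (productProperty M Φ S).HasTwoOutOfThreeProperty where
  comp_mem f g hf hg := by
    rw [productProperty_iff] at hf hg ⊢
    filter_upwards [hf, hg, comp f g]
    rintro i ⟨f', hf, h₁⟩ ⟨g', hg, h₂⟩ h
    exact ⟨_, h _ _ hf hg, S.comp_mem _ _ h₁ h₂⟩
  of_postcomp f g hg hfg := by
    rw [productProperty_iff] at hg hfg ⊢
    filter_upwards [eventually_exists f, hg, hfg, comp f g]
    rintro i ⟨f', hf⟩ ⟨g', hg, h₁⟩ ⟨k, hk, h₂⟩ h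
    obtain rfl := hk.unique (h _ _ hf hg)
    exact ⟨_, hf, S.of_postcomp _ _ h₁ h₂⟩
  of_precomp f g hf hfg := by
    rw [productProperty_iff] at hf hfg ⊢
    filter_upwards [eventually_exists g, hf, hfg, comp f g]
    rintro i ⟨g', hg⟩ ⟨f', hf, h₁⟩ ⟨k, hk, h₂⟩ h
    obtain rfl := hk.unique (h _ _ hf hg)
    exact ⟨_, hg, S.of_precomp _ _ h₁ h₂⟩

/-- The components of a lifting problem eventually form lifting problems that are solvable by `H`;
the solutions glue to a germ. -/
lemma productProperty_hasLiftingProperty {S T : MorphismProperty M} [S.ContainsIdentities]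
    [S.RespectsIso] [T.ContainsIdentities] [T.RespectsIso]
    (H : ∀ {A B X Y : M} (i : A ⟶ B) (p : X ⟶ Y), S i → T p → HasLiftingProperty i p)
    {A B X Y : FilterProduct M Φ} {i : A ⟶ B} {p : X ⟶ Y} (hi : productProperty M Φ S i)
    (hp : productProperty M Φ T p) : HasLiftingProperty i p where
  sq_hasLift {t b} sq := by
    rw [productProperty_iff] at hi hp
    obtain ⟨l, hl⟩ := exists_hom (X := B) (Y := X) (Φ := Φ) (p := fun k l => ∃ i' p' t' b',
        HasComponent i k i' ∧ HasComponent p k p' ∧ HasComponent t k t' ∧ HasComponent b k b' ∧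
        i' ≫ l = t' ∧ l ≫ p' = b') (by
      filter_upwards [hi, hp, eventually_exists t, eventually_exists b, comp_eq_comp sq.w]
      rintro k ⟨i', hi, hS⟩ ⟨p', hp, hT⟩ ⟨t', ht⟩ ⟨b', hb⟩ e
      have := H i' p' hS hT
      have sq' : CommSq t' i' p' b' := ⟨e _ _ _ _ ht hp hi hb⟩
      exact ⟨sq'.lift, i', p', t', b', hi, hp, ht, hb, by simp, by simp⟩)
    refine ⟨⟨⟨l, comp_eq_of ?_, comp_eq_of ?_⟩⟩⟩ <;> filter_upwards [hl] <;>
      rintro k ⟨l', hl, i', p', t', b', hi, hp, ht, hb, e₁, e₂⟩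
    · exact ⟨_, _, _, hi, hl, ht, e₁⟩
    · exact ⟨_, _, _, hl, hp, hb, e₂⟩

/-- As for pullbacks, the middle object is fixed at all indices first, and then the two factors are
chosen successively. -/
lemma productProperty_hasFactorization (S T : MorphismProperty M) [S.ContainsIdentities]
    [S.RespectsIso] [T.ContainsIdentities] [T.RespectsIso] [S.HasFactorization T] :
    (productProperty M Φ S).HasFactorization (productProperty M Φ T) where
  nonempty_mapFactorizationData {X Y} f := by
    have (i : I) : ∃ Q : M, ∀ f', HasComponent f i f' → ∃ (p : X.as i ⟶ Q) (q : Q ⟶ Y.as i),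
        p ≫ q = f' ∧ S p ∧ T q := by
      by_cases hi : ∃ f', HasComponent f i f'
      · obtain ⟨f', hf⟩ := hi
        have d := MorphismProperty.factorizationData S T f'
        exact ⟨d.Z, fun f'' hf' => ⟨d.i, d.p, d.fac.trans (hf.unique hf'), d.hi, d.hp⟩⟩
      · exact ⟨X.as i, fun f' hf => (hi ⟨f', hf⟩).elim⟩
    choose Q hQ using this
    obtain ⟨p, hp⟩ := exists_hom (X := X) (Y := ⟨Q⟩) (Φ := Φ) (p := fun i p => ∃ q f',
        HasComponent f i f' ∧ p ≫ q = f' ∧ S p ∧ T q) (by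
      filter_upwards [eventually_exists f]
      rintro i ⟨f', hf⟩
      obtain ⟨p, q, h⟩ := hQ i f' hf
      exact ⟨p, q, f', hf, h⟩)
    obtain ⟨q, hq⟩ := exists_hom (X := ⟨Q⟩) (Y := Y) (Φ := Φ) (p := fun i q => ∃ p' f',
        HasComponent p i p' ∧ HasComponent f i f' ∧ p' ≫ q = f' ∧ S p' ∧ T q) (by
      filter_upwards [hp]
      rintro i ⟨p', hp, q, f', hf, h⟩
      exact ⟨q, p', f', hp, hf, h⟩)
    refine ⟨⟨_, p, q, comp_eq_of ?_, (productProperty_iff p).2 ?_,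
      (productProperty_iff q).2 ?_⟩⟩ <;>
      filter_upwards [hq] <;> rintro i ⟨q', hq, p', f', hp, hf, e, hS, hT⟩
    · exact ⟨_, _, _, hp, hq, hf, e⟩
    · exact ⟨_, hp, hS⟩
    · exact ⟨_, hq, hT⟩

end Model

/-! ### The model structure on the filter product. -/

section ModelStructure

variable (M : Type u) [Category.{v} M] [ModelCategory M] [HasStrictInitialObjects M]
  {I : Type w} (Φ : Filter I)

/-- The model structure on the filter product. -/
@[reducible]
def filterProductModelCategory : ModelCategory (FilterProduct M Φ) :=
  letI c₁ : CategoryWithFibrations (FilterProduct M Φ) := ⟨productProperty M Φ (fibrations M)⟩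
  letI c₂ : CategoryWithCofibrations (FilterProduct M Φ) := ⟨productProperty M Φ (cofibrations M)⟩
  letI c₃ : CategoryWithWeakEquivalences (FilterProduct M Φ) :=
    ⟨productProperty M Φ (weakEquivalences M)⟩
  -- Being a cofibration and being a weak equivalence are a priori witnessed by different
  -- representatives. Uniqueness of components merges them, so that lifting and factorization apply
  -- with one class of `M`.
  have h₁ : trivialCofibrations (FilterProduct M Φ) =
    productProperty M Φ (trivialCofibrations M) := productProperty_inf _ _
  have h₂ : trivialFibrations (FilterProduct M Φ) =
    productProperty M Φ (trivialFibrations M) := productProperty_inf _ _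
  { categoryWithFibrations := c₁
    categoryWithCofibrations := c₂
    categoryWithWeakEquivalences := c₃
    cm2 := productProperty_hasTwoOutOfThree _
    cm3a := productProperty_isStableUnderRetracts _
    cm3b := productProperty_isStableUnderRetracts _
    cm3c := productProperty_isStableUnderRetracts _
    cm4a := fun i p hi hi' hp =>
      productProperty_hasLiftingProperty (S := trivialCofibrations M) (T := fibrations M)
        (fun _ _ hi hp => MorphismProperty.hasLiftingProperty_of_wfs _ _ hi hp)
        (by rw [← h₁]; exact ⟨hi.mem, hi'.mem⟩) hp.mem
    cm4b := fun i p hi hp hp' =>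
      productProperty_hasLiftingProperty (S := cofibrations M) (T := trivialFibrations M)
        (fun _ _ hi hp => MorphismProperty.hasLiftingProperty_of_wfs _ _ hi hp)
        hi.mem (by rw [← h₂]; exact ⟨hp.mem, hp'.mem⟩)
    cm5a := by rw [h₁]; exact productProperty_hasFactorization _ _
    cm5b := by rw [h₂]; exact productProperty_hasFactorization _ _ }

lemma isFilterProductModel_filterProductModelCategory :
    letI := filterProductModelCategory M Φ
    IsFilterProductModel M Φ :=
  letI := filterProductModelCategory M Φ
  ⟨rfl, rfl, rfl⟩

end ModelStructure

open HasComponent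

/-! ### Functors and adjunctions induced on filter products. -/

section Functoriality

variable {M : Type u₁} [Category.{v₁} M]
  [HasInitial M] [HasTerminal M] [HasBinaryProducts M] [HasStrictInitialObjects M]
  {N : Type u₂} [Category.{v₂} N]
  [HasInitial N] [HasTerminal N] [HasBinaryProducts N] [HasStrictInitialObjects N]
  {I : Type w} (Φ : Filter I)

/-- The morphism of the filter product induced by a morphism between functors. -/
abbrev homOfApp {X Y : FilterProduct M Φ} (f : ∀ i, X.as i ⟶ Y.as i) : X ⟶ Y :=
  (proj M Φ).map (X := X.as) (Y := Y.as) f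

variable {Φ} in
lemma HasComponent.of_homOfApp {X Y : FilterProduct M Φ} (f : ∀ i, X.as i ⟶ Y.as i) :
    ∀ᶠ i in Φ, HasComponent (homOfApp Φ f) i (f i) :=
  of_proj_map (X := X.as) (Y := Y.as) f

section

variable (F : M ⥤ N)

variable {Φ} in
/-- The action of the componentwise functor on morphisms of the filter product. -/
def mapHom {X Y : FilterProduct M Φ} (φ : X ⟶ Y) :
    (⟨fun i => F.obj (X.as i)⟩ : FilterProduct N Φ) ⟶ ⟨fun i => F.obj (Y.as i)⟩ :=
  germ (X := fun i => F.obj (X.as i)) (Y := fun i => F.obj (Y.as i)) fun i =>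
    F.map (component φ i)

variable {Φ} in
lemma HasComponent.of_mapHom {X Y : FilterProduct M Φ} (φ : X ⟶ Y) :
    ∀ᶠ i in Φ, ∀ f, HasComponent φ i f → HasComponent (mapHom F φ) i (F.map f) := by
  filter_upwards [of_germ (X := fun i => F.obj _) (Y := fun i => F.obj _)
    fun i => F.map (component φ i)]
  rintro i h f ⟨hi, rfl⟩
  exact h hi

/-- The functor between filter products induced by a functor. -/
@[reducible]
def mapFunctor : FilterProduct M Φ ⥤ FilterProduct N Φ where
  obj X := ⟨fun i => F.obj (X.as i)⟩
  map φ := mapHom F φ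
  map_id X := ext (by
    filter_upwards [of_mapHom F (𝟙 X), of_id X,
      of_id (⟨fun i => F.obj (X.as i)⟩ : FilterProduct N Φ)] with i h hX hX'
    exact ⟨_, h _ hX, by rwa [F.map_id]⟩)
  map_comp φ ψ := (comp_eq_of (by
    filter_upwards [of_mapHom F (φ ≫ ψ), of_mapHom F φ, of_mapHom F ψ, comp φ ψ,
      eventually_exists φ, eventually_exists ψ]
    rintro i h₁ h₂ h₃ h ⟨f, hf⟩ ⟨g, hg⟩
    exact ⟨_, _, _, h₂ f hf, h₃ g hg, h₁ _ (h _ _ hf hg), (F.map_comp _ _).symm⟩)).symm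

variable {Φ} in
lemma HasComponent.of_mapFunctor {X Y : FilterProduct M Φ} (φ : X ⟶ Y) :
    ∀ᶠ i in Φ, ∀ f, HasComponent φ i f → HasComponent ((mapFunctor Φ F).map φ) i (F.map f) :=
  of_mapHom F φ

/-- The functor is defined through chosen representatives; this shows that any representative may be
used. -/
lemma mapFunctor_map_germ {X Y : I → M} {J : Members Φ} (f : ∀ i : J.1, X i ⟶ Y i) :
    (mapFunctor Φ F).map (germ f) =
      germ (X := fun i => F.obj (X i)) (Y := fun i => F.obj (Y i)) fun i => F.map (f i) := by
  refine ext ?_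
  filter_upwards [J.2, of_germ f,
    of_germ (X := fun i => F.obj _) (Y := fun i => F.obj _) fun i => F.map (f i), of_mapFunctor F (germ f)]
    with i hi h₁ h₂ h
  exact ⟨_, h _ (h₁ hi), h₂ hi⟩

/-- The functor induced on the filter products is compatible with the projections. -/
def projCompMapFunctor :
    proj M Φ ⋙ mapFunctor Φ F ≅ Functor.pi (fun _ : I => F) ⋙ proj N Φ :=
  NatIso.ofComponents (fun X => Iso.refl _) fun {X Y} f => by
    refine (Category.comp_id _).trans (Eq.trans ?_ (Category.id_comp _).symm)
    refine ext ?_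
    filter_upwards [of_proj_map (Φ := Φ) f, of_mapFunctor F ((proj M Φ).map f),
      of_proj_map (Φ := Φ) ((Functor.pi fun _ : I => F).map f)] with i h₁ h₂ h₃
    exact ⟨_, h₂ _ h₁, h₃⟩

end

/-- The induced functors on filter products depend functorially on the given functor. -/
def mapFunctorFunctor : (M ⥤ N) ⥤ (FilterProduct M Φ ⥤ FilterProduct N Φ) where
  obj F := mapFunctor Φ F
  map {F F'} α :=
    { app := fun X => homOfApp Φ (X := ⟨_⟩) (Y := ⟨_⟩) fun i => α.app (X.as i)
      naturality := fun X Y φ => comp_eq_comp_of (by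
        filter_upwards [eventually_exists φ, of_mapFunctor F φ, of_mapFunctor F' φ,
          of_homOfApp (Φ := Φ) (X := ⟨_⟩) (Y := ⟨_⟩) fun i => α.app (X.as i),
          of_homOfApp (Φ := Φ) (X := ⟨_⟩) (Y := ⟨_⟩) fun i => α.app (Y.as i)]
        rintro i ⟨f, hf⟩ h h' hX hY
        exact ⟨_, _, _, _, h f hf, hY, hX, h' f hf, α.naturality f⟩) }
  map_id F := by
    ext X
    exact (proj N Φ).map_id _
  map_comp α β := by
    ext X
    exact (proj N Φ).map_comp _ _

variable {F : M ⥤ N} {G : N ⥤ M}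

/-- The adjunction between filter products induced by an adjunction. -/
def mapAdjunction (adj : F ⊣ G) : mapFunctor Φ F ⊣ mapFunctor Φ G :=
  Adjunction.mkOfUnitCounit
    { unit :=
        { app := fun X => homOfApp Φ (X := X) (Y := ⟨_⟩) fun i => adj.unit.app (X.as i)
          naturality := fun X Y φ => comp_eq_comp_of (by
            filter_upwards [eventually_exists φ, of_mapFunctor F φ,
              of_mapFunctor G ((mapFunctor Φ F).map φ),
              of_homOfApp (Φ := Φ) (X := ⟨_⟩) (Y := ⟨_⟩) fun i => adj.unit.app (X.as i),
              of_homOfApp (Φ := Φ) (X := ⟨_⟩) (Y := ⟨_⟩) fun i => adj.unit.app (Y.as i)]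
            rintro i ⟨f, hf⟩ h h' hX hY
            exact ⟨_, _, _, _, hf, hY, hX, h' _ (h f hf), adj.unit.naturality f⟩) }
      counit :=
        { app := fun X => homOfApp Φ (X := ⟨_⟩) (Y := X) fun i => adj.counit.app (X.as i)
          naturality := fun X Y φ => comp_eq_comp_of (by
            filter_upwards [eventually_exists φ, of_mapFunctor G φ,
              of_mapFunctor F ((mapFunctor Φ G).map φ),
              of_homOfApp (Φ := Φ) (X := ⟨_⟩) (Y := ⟨_⟩) fun i => adj.counit.app (X.as i),
              of_homOfApp (Φ := Φ) (X := ⟨_⟩) (Y := ⟨_⟩) fun i => adj.counit.app (Y.as i)]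
            rintro i ⟨f, hf⟩ h h' hX hY
            exact ⟨_, _, _, _, h' _ (h f hf), hY, hX, hf, adj.counit.naturality f⟩) }
      left_triangle := by
        ext X
        -- The middle factor of the triangle is a component of the associator, which is an identity.
        refine (congrArg (_ ≫ ·) (Category.id_comp _)).trans (comp_eq_of ?_)
        have hX := of_homOfApp (Φ := Φ) (X := X) (Y := ⟨_⟩) fun i => adj.unit.app (X.as i)
        filter_upwards [hX, of_mapFunctor F _, of_homOfApp (Φ := Φ) (X := ⟨_⟩) (Y := ⟨_⟩) fun i =>
            adj.counit.app (F.obj (X.as i)), of_id ((mapFunctor Φ F).obj X)]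
          with i h₁ h₂ h₃ h₄
        exact ⟨_, _, _, h₂ _ h₁, h₃, h₄, adj.left_triangle_components _⟩
      right_triangle := by
        ext X
        refine (congrArg (_ ≫ ·) (Category.id_comp _)).trans (comp_eq_of ?_)
        have hX := of_homOfApp (Φ := Φ) (X := ⟨_⟩) (Y := X) fun i => adj.counit.app (X.as i)
        filter_upwards [hX, of_mapFunctor G _, of_homOfApp (Φ := Φ) (X := ⟨_⟩) (Y := ⟨_⟩) fun i =>
            adj.unit.app (G.obj (X.as i)), of_id ((mapFunctor Φ G).obj X)]
          with i h₁ h₂ h₃ h₄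
        exact ⟨_, _, _, h₃, h₂ _ h₁, h₄, adj.right_triangle_components _⟩ }

end Functoriality

/-! ### Quillen adjunctions, localizations and equivalences between filter products. -/

section Quillen

variable {M : Type u₁} [Category.{v₁} M] [ModelCategory M] [HasStrictInitialObjects M]
  {N : Type u₂} [Category.{v₂} N] [ModelCategory N] [HasStrictInitialObjects N]
  {I : Type w} {Φ : Filter I} {F : M ⥤ N} {G : N ⥤ M}

variable (Φ) in
-- Both comparison isomorphisms have identity components, so after cancelling them the condition is
-- the definition of the unit.
lemma isInducedAdjunction_mapAdjunction (adj : F ⊣ G) :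
    IsInducedAdjunction adj Φ (mapAdjunction Φ adj) := by
  refine ⟨projCompMapFunctor Φ F, projCompMapFunctor Φ G, fun X => ?_⟩
  have h₁ : (projCompMapFunctor Φ F).hom.app X = 𝟙 ((mapFunctor Φ F).obj ((proj M Φ).obj X)) := rfl
  have h₂ : (projCompMapFunctor Φ G).hom.app (fun i => F.obj (X i)) =
    𝟙 ((mapFunctor Φ G).obj ((mapFunctor Φ F).obj ((proj M Φ).obj X))) := rfl
  refine (congrArg (_ ≫ ·) ?_).trans (Category.comp_id _)
  exact (congrArg₂ (· ≫ ·) ((congrArg _ h₁).trans ((mapFunctor Φ G).map_id _)) h₂).trans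
    (Category.comp_id _)

namespace IsFilterProductModel

variable [ModelCategory (FilterProduct M Φ)] (hM : IsFilterProductModel M Φ)

include hM

variable {X Y : FilterProduct M Φ}

lemma cofibration_iff (f : X ⟶ Y) :
    Cofibration f ↔ ∀ᶠ i in Φ, ∃ g, HasComponent f i g ∧ Cofibration g := by
  simp only [HomotopicalAlgebra.cofibration_iff, hM.cofibrations_eq, productProperty_iff]

lemma fibration_iff (f : X ⟶ Y) :
    Fibration f ↔ ∀ᶠ i in Φ, ∃ g, HasComponent f i g ∧ Fibration g := by
  simp only [HomotopicalAlgebra.fibration_iff, hM.fibrations_eq, productProperty_iff]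

lemma weakEquivalence_iff (f : X ⟶ Y) :
    WeakEquivalence f ↔ ∀ᶠ i in Φ, ∃ g, HasComponent f i g ∧ WeakEquivalence g := by
  simp only [HomotopicalAlgebra.weakEquivalence_iff, hM.weakEquivalences_eq, productProperty_iff]

/-- The componentwise initial object is initial in the filter product, so cofibrancy can be tested
on the germ of the morphisms out of the initial object. The fibrant case uses the terminal object.
-/
lemma isCofibrant_iff : IsCofibrant X ↔ ∀ᶠ i in Φ, IsCofibrant (X.as i) := by
  have h := isInitialMk Φ (M := M) fun _ => initialIsInitial
  rw [isCofibrant_iff_of_isInitial (homOfApp Φ (X := ⟨_⟩) fun i => initial.to (X.as i)) h,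
    hM.cofibration_iff]
  refine Filter.eventually_congr ?_
  filter_upwards [of_homOfApp (Φ := Φ) (X := ⟨_⟩) (Y := X) fun i => initial.to (X.as i)] with i hi
  rw [HomotopicalAlgebra.isCofibrant_iff]
  exact ⟨fun ⟨g, hg, h⟩ => hi.unique hg ▸ h, fun h => ⟨_, hi, h⟩⟩

lemma isFibrant_iff : IsFibrant X ↔ ∀ᶠ i in Φ, IsFibrant (X.as i) := by
  have h := isTerminalMk Φ (M := M) fun _ => terminalIsTerminal
  rw [isFibrant_iff_of_isTerminal (homOfApp Φ (Y := ⟨_⟩) fun i => terminal.from (X.as i)) h,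
    hM.fibration_iff]
  refine Filter.eventually_congr ?_
  filter_upwards [of_homOfApp (Φ := Φ) (X := X) (Y := ⟨_⟩) fun i => terminal.from (X.as i)]
    with i hi
  rw [HomotopicalAlgebra.isFibrant_iff]
  exact ⟨fun ⟨g, hg, h⟩ => hi.unique hg ▸ h, fun h => ⟨_, hi, h⟩⟩

end IsFilterProductModel

variable [ModelCategory (FilterProduct M Φ)] (hM : IsFilterProductModel M Φ)
  [ModelCategory (FilterProduct N Φ)] (hN : IsFilterProductModel N Φ) {adj : F ⊣ G}

include hM hN

lemma isQuillenAdjunction_mapAdjunction (h : IsQuillenAdjunction adj) :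
    IsQuillenAdjunction (mapAdjunction Φ adj) where
  cofibration f hf := by
    rw [hM.cofibration_iff] at hf
    rw [hN.cofibration_iff]
    filter_upwards [hf, of_mapFunctor F f]
    rintro i ⟨g, hg, hg'⟩ H
    exact ⟨_, H _ hg, h.cofibration _ hg'⟩
  trivialCofibration f hf hf' := by
    rw [hM.cofibration_iff] at hf
    rw [hM.weakEquivalence_iff] at hf'
    rw [hN.weakEquivalence_iff]
    filter_upwards [hf, hf', of_mapFunctor F f]
    rintro i ⟨g, hg, h₁⟩ ⟨g', hg', h₂⟩ H
    obtain rfl := hg.unique hg'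
    exact ⟨_, H _ hg, h.trivialCofibration _ h₁ h₂⟩

/-- A cofibrant replacement of `G Y` with `Y` fibrant has, eventually, components of the same kind,
and the derived counit has as components the derived counits of `adj`. -/
lemma isHomotopicalLocalization_mapAdjunction (h : IsHomotopicalLocalization adj) :
    IsHomotopicalLocalization (mapAdjunction Φ adj) := fun Y Q q hY hQ hq => by
  rw [hM.weakEquivalence_iff] at hq
  rw [hN.isFibrant_iff] at hY
  rw [hM.isCofibrant_iff] at hQ
  rw [hN.weakEquivalence_iff]
  filter_upwards [hq, hY, hQ, of_mapFunctor F q, comp ((mapFunctor Φ F).map q) _,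
    of_homOfApp (Φ := Φ) (X := ⟨_⟩) (Y := Y) fun i => adj.counit.app (Y.as i)]
  rintro i ⟨q', hq, hq'⟩ hY hQ H H' hc
  exact ⟨_, H' _ _ (H _ hq) hc, h _ _ _ hY hQ hq'⟩

lemma isHomotopicalColocalization_mapAdjunction (h : IsHomotopicalColocalization adj) :
    IsHomotopicalColocalization (mapAdjunction Φ adj) := fun X R j hX hR hj => by
  rw [hN.weakEquivalence_iff] at hj
  rw [hM.isCofibrant_iff] at hX
  rw [hN.isFibrant_iff] at hR
  rw [hM.weakEquivalence_iff]
  filter_upwards [hj, hX, hR, of_mapFunctor G j, comp _ ((mapFunctor Φ G).map j),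
    of_homOfApp (Φ := Φ) (X := X) (Y := ⟨_⟩) fun i => adj.unit.app (X.as i)]
  rintro i ⟨j', hj, hj'⟩ hX hR H H' hc
  exact ⟨_, H' _ _ hc (H _ hj), h _ _ _ hX hR hj'⟩

/-- The transpose of `f` has as components the transposes of the components of `f`, so both sides of
the equivalence are eventual conditions that agree at eventually all indices. -/
lemma isQuillenEquivalence_mapAdjunction (h : IsQuillenEquivalence adj) :
    IsQuillenEquivalence (mapAdjunction Φ adj) := by
  refine ⟨isQuillenAdjunction_mapAdjunction hM hN h.1, fun X Y f hX hY => ?_⟩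
  rw [hM.isCofibrant_iff] at hX
  rw [hN.isFibrant_iff] at hY
  rw [hN.weakEquivalence_iff, hM.weakEquivalence_iff, Adjunction.homEquiv_unit]
  refine Filter.eventually_congr ?_
  filter_upwards [hX, hY, eventually_exists f, of_mapFunctor G f, comp _ ((mapFunctor Φ G).map f),
    of_homOfApp (Φ := Φ) (X := X) (Y := ⟨_⟩) fun i => adj.unit.app (X.as i)]
  rintro i hX hY ⟨f', hf⟩ H H' hc
  have hf' := H' _ _ hc (H _ hf)
  have key := h.2 (X.as i) (Y.as i) f' hX hY
  have e : adj.homEquiv (X.as i) (Y.as i) f' = adj.unit.app (X.as i) ≫ G.map f' :=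
    adj.homEquiv_unit ..
  rw [e] at key
  constructor
  · rintro ⟨g, hg, hw⟩
    obtain rfl := hf.unique hg
    exact ⟨_, hf', key.1 hw⟩
  · rintro ⟨g, hg, hw⟩
    obtain rfl := hf'.unique hg
    exact ⟨_, hf, key.2 hw⟩

end Quillen

/-! ### Morphisms of filter products as germs of families -/

section HomOfFamily

variable {M : Type u₁} [Category.{v₁} M]
  [HasInitial M] [HasTerminal M] [HasBinaryProducts M]
  {I : Type w} {Φ : Filter I} {X Y Z : FilterProduct M Φ}

/-- The morphism of the filter product given by a family of morphisms. -/
def homOfFamily {J : Members Φ} (f : ∀ i : J.1, X.as i ⟶ Y.as i) : X ⟶ Y :=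
  germ (X := X.as) (Y := Y.as) f

variable [HasStrictInitialObjects M]

lemma homOfFamily_restrict {J K : Members Φ} (h : K ≤ J) (f : ∀ i : J.1, X.as i ⟶ Y.as i) :
    homOfFamily (fun i : K.1 => f ⟨i.1, h i.2⟩) = homOfFamily f :=
  germ_restrict h f

lemma homOfFamily_comp {J : Members Φ} (f : ∀ i : J.1, X.as i ⟶ Y.as i)
    (g : ∀ i : J.1, Y.as i ⟶ Z.as i) :
    homOfFamily f ≫ homOfFamily g = homOfFamily fun i => f i ≫ g i :=
  germ_comp f g

lemma homOfApp_eq_homOfFamily (f : ∀ i, X.as i ⟶ Y.as i) (J : Members Φ) :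
    homOfApp Φ f = homOfFamily fun i : J.1 => f i :=
  proj_map_eq_germ (X := X.as) (Y := Y.as) f J

lemma homOfFamily_id (X : FilterProduct M Φ) (J : Members Φ) :
    homOfFamily (fun i : J.1 => 𝟙 (X.as i)) = 𝟙 X :=
  germ_id X.as J

lemma exists_homOfFamily_eq (φ : X ⟶ Y) :
    ∃ J : Members Φ, ∀ K ≤ J, ∃ f : ∀ i : K.1, X.as i ⟶ Y.as i, homOfFamily f = φ :=
  exists_germ_eq φ

variable {N : Type u₂} [Category.{v₂} N]
  [HasInitial N] [HasTerminal N] [HasBinaryProducts N] [HasStrictInitialObjects N]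

lemma mapFunctor_map_homOfFamily (F : M ⥤ N) {J : Members Φ} (f : ∀ i : J.1, X.as i ⟶ Y.as i) :
    (mapFunctor Φ F).map (homOfFamily f) =
      homOfFamily (X := (mapFunctor Φ F).obj X) (Y := (mapFunctor Φ F).obj Y)
        fun i => F.map (f i) :=
  mapFunctor_map_germ Φ F f

end HomOfFamily

/-! ### Filtered colimits of products over the members of a filter -/

section ProdDiagram

variable {V : Type u₃} [Category.{v₃} V] {I : Type w} (Φ : Filter I)
  [∀ J : Set I, HasProductsOfShape J V]

/-- The projection `∏_{i ∈ J} T i ⟶ ∏_{i ∈ K} T i` for `K ≤ J`. -/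
def restrictProd {Φ : Filter I} (T : I → V) {J K : Members Φ} (h : K ≤ J) :
    (∏ᶜ fun i : J.1 => T i) ⟶ ∏ᶜ fun i : K.1 => T i :=
  Pi.lift fun i : K.1 => Pi.π (fun i : J.1 => T i) ⟨i.1, h i.2⟩

/-- The filtered diagram `J ↦ ∏_{i ∈ J} T i`. -/
def prodDiagram (T : I → V) : (Members Φ)ᵒᵖ ⥤ V where
  obj J := ∏ᶜ fun i : J.unop.1 => T i
  map {J K} h := restrictProd T (leOfHom h.unop)
  map_id J := Pi.hom_ext _ _ fun i => by simp [restrictProd]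
  map_comp _ _ := Pi.hom_ext _ _ fun i => by simp [restrictProd]

instance : IsFiltered (Members Φ)ᵒᵖ := isFiltered_op_of_isCofiltered _

variable {Φ} {T T' T'' : I → V}

/-- The morphism from `∏_{i ∈ J} T i` to the point of a cocone. -/
def fromProd (c : Cocone (prodDiagram Φ T)) (J : Members Φ) :
    (∏ᶜ fun i : J.1 => T i) ⟶ c.pt :=
  c.ι.app (op J)

section

variable (c : Cocone (prodDiagram Φ T))

lemma restrictProd_fromProd {J K : Members Φ} (h : K ≤ J) :
    restrictProd T h ≫ fromProd c K = fromProd c J :=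
  c.w (homOfLE h).op

lemma lift_fromProd_of_le {J K : Members Φ} (h : K ≤ J) {Z : V} (f : ∀ i : J.1, Z ⟶ T i) :
    Pi.lift (fun i : K.1 => f ⟨i.1, h i.2⟩) ≫ fromProd c K = Pi.lift f ≫ fromProd c J := by
  rw [← restrictProd_fromProd c h, ← Category.assoc]
  congr 1
  refine Pi.hom_ext _ _ fun i => ?_
  simp [restrictProd]

variable {c} (hc : IsColimit c) {c' : Cocone (prodDiagram Φ T')} (hc' : IsColimit c')
  {c'' : Cocone (prodDiagram Φ T'')} (hc'' : IsColimit c'')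

include hc in
-- The members below `J₀` are cofinal, so it suffices to test at stages where given families are
-- defined.
lemma hom_ext_of_le (J₀ : Members Φ) {Z : V} {f g : c.pt ⟶ Z}
    (h : ∀ J ≤ J₀, fromProd c J ≫ f = fromProd c J ≫ g) : f = g :=
  hc.hom_ext fun ⟨J⟩ => by
    change fromProd c J ≫ f = fromProd c J ≫ g
    rw [← restrictProd_fromProd c (inf_le_left : J ⊓ J₀ ≤ J), Category.assoc, Category.assoc,
      h _ inf_le_right]

lemma lift_fromProd_eq_of_eventuallyEq {Z : V} {J K : Members Φ} {f : ∀ i : J.1, Z ⟶ T i}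
    {g : ∀ i : K.1, Z ⟶ T i} (h : ∀ᶠ i in Φ, ∀ hJ hK, f ⟨i, hJ⟩ = g ⟨i, hK⟩) :
    Pi.lift f ≫ fromProd c J = Pi.lift g ≫ fromProd c K := by
  let L : Members Φ := ⟨_, Filter.inter_mem (Filter.inter_mem J.2 K.2) h⟩
  have hJ : L ≤ J := fun i hi => hi.1.1
  have hK : L ≤ K := fun i hi => hi.1.2
  rw [← lift_fromProd_of_le c hJ, ← lift_fromProd_of_le c hK]
  congr 2
  funext i
  exact i.2.2 _ _

/-! ### Morphisms from a compact object to a filtered colimit of products. -/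

section Compact

variable {Z : V} [IsFinitelyPresentable.{w} Z]

include hc

/-- By compactness `f` factors through some stage `J`, and a morphism to a product is a family. -/
lemma exists_lift_fromProd_eq (f : Z ⟶ c.pt) :
    ∃ (J : Members Φ) (g : ∀ i : J.1, Z ⟶ T i), Pi.lift g ≫ fromProd c J = f := by
  obtain ⟨⟨J⟩, p, hp⟩ := IsFinitelyPresentable.exists_hom_of_isColimit hc f
  refine ⟨J, fun i => p ≫ Pi.π (fun i : J.1 => T i) i, ?_⟩
  rw [← hp]
  refine congrArg (· ≫ _) (Pi.hom_ext _ _ fun i => ?_)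
  exact limit.lift_π _ _

/-- Two morphisms from a compact object become equal in the colimit only if they already agree at
some later stage `L`. This is the same criterion as `germ_eq_iff`, and so `homEquivOfCompact` is
well behaved. -/
lemma lift_fromProd_eq_iff {J K : Members Φ} {f : ∀ i : J.1, Z ⟶ T i} {g : ∀ i : K.1, Z ⟶ T i} :
    Pi.lift f ≫ fromProd c J = Pi.lift g ≫ fromProd c K ↔
      ∀ᶠ i in Φ, ∀ hJ hK, f ⟨i, hJ⟩ = g ⟨i, hK⟩ := by
  refine ⟨fun h => ?_, lift_fromProd_eq_of_eventuallyEq⟩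
  obtain ⟨⟨L⟩, a, b, h⟩ := IsFinitelyPresentable.exists_eq_of_isColimit hc (i := op J) (j := op K)
    (Pi.lift f) (Pi.lift g) h
  filter_upwards [L.2] with i hi _ _
  have := congrArg (· ≫ Pi.π (fun i : L.1 => T i) ⟨i, hi⟩) h
  simpa [prodDiagram, restrictProd] using this

variable {M : Type u₁} [Category.{v₁} M] [HasInitial M] [HasTerminal M] [HasBinaryProducts M]
  [HasStrictInitialObjects M] {X Y : FilterProduct M Φ}

/-- A family of identifications `Hom(X i, Y i) ≃ Hom(Z, T i)` with `Z` compact induces an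
identification of the morphisms of the filter product with the morphisms from `Z` to the filtered
colimit of the products of the objects `T i`. -/
def homEquivOfCompact (e : ∀ i, (X.as i ⟶ Y.as i) ≃ (Z ⟶ T i)) : (X ⟶ Y) ≃ (Z ⟶ c.pt) :=
  Equiv.ofBijective
    (fun φ => Pi.lift (f := fun i : (support φ).1 => T i)
      (fun i => e i (component φ i)) ≫ fromProd c (support φ)) (by
  constructor
  · intro φ ψ h
    rw [lift_fromProd_eq_iff hc] at h
    refine (germ_component φ).symm.trans (Eq.trans (germ_eq_iff.2 ?_) (germ_component ψ))
    filter_upwards [h] with i h hJ hK using (e i).injective (h hJ hK)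
  · intro f
    obtain ⟨J, g, rfl⟩ := exists_lift_fromProd_eq hc f
    let φ : X ⟶ Y := homOfFamily (J := J) fun i => (e i).symm (g i)
    -- The representative chosen for `φ` need not be the family just written down, but agrees with
    -- it eventually, which suffices in the colimit.
    refine ⟨φ, lift_fromProd_eq_of_eventuallyEq ?_⟩
    filter_upwards [germ_eq_iff.1 (germ_component φ)] with i h hJ hK
    rw [h hJ hK, Equiv.apply_symm_apply])

lemma homEquivOfCompact_homOfFamily (e : ∀ i, (X.as i ⟶ Y.as i) ≃ (Z ⟶ T i)) {J : Members Φ}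
    (f : ∀ i : J.1, X.as i ⟶ Y.as i) :
    homEquivOfCompact hc e (homOfFamily f) =
      Pi.lift (f := fun i : J.1 => T i) (fun i => e i (f i)) ≫ fromProd c J := by
  refine lift_fromProd_eq_of_eventuallyEq ?_
  filter_upwards [germ_eq_iff.1 (germ_component (homOfFamily f))] with i h hJ hK
  rw [h hJ hK]

end Compact

/-- The morphism between products over `J` induced by a family of morphisms. -/
def prodMap (f : ∀ i, T i ⟶ T' i) (J : Members Φ) :
    (∏ᶜ fun i : J.1 => T i) ⟶ ∏ᶜ fun i : J.1 => T' i :=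
  Pi.lift fun i => Pi.π _ i ≫ f i

lemma restrictProd_prodMap_fromProd (c' : Cocone (prodDiagram Φ T')) (f : ∀ i, T i ⟶ T' i)
    {J K : Members Φ} (h : K ≤ J) :
    restrictProd T h ≫ prodMap f K ≫ fromProd c' K = prodMap f J ≫ fromProd c' J := by
  rw [← restrictProd_fromProd c' h, ← Category.assoc, ← Category.assoc]
  exact congrArg (· ≫ _) (Pi.hom_ext _ _ fun i => by simp [restrictProd, prodMap])

/-- The morphism between filtered colimits of products induced by a family of morphisms. -/
def colimMapOfFamily (c' : Cocone (prodDiagram Φ T')) (f : ∀ i, T i ⟶ T' i) : c.pt ⟶ c'.pt :=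
  hc.desc (Cocone.mk c'.pt
    { app := fun J => prodMap f J.unop ≫ fromProd c' J.unop
      naturality := fun J K h => by
        exact (restrictProd_prodMap_fromProd c' f (leOfHom h.unop)).trans
          (Category.comp_id _).symm })

lemma fromProd_colimMapOfFamily (c' : Cocone (prodDiagram Φ T')) (f : ∀ i, T i ⟶ T' i)
    (J : Members Φ) :
    fromProd c J ≫ colimMapOfFamily hc c' f = prodMap f J ≫ fromProd c' J :=
  hc.fac _ _

/-! ### Tensor products of filtered colimits of products. -/

section Tensor

variable [MonoidalCategory V]

/-- The bilinear operation on products induced by a family of bilinear operations. -/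
def prodMul (m : ∀ i, T i ⊗ T' i ⟶ T'' i) (J : Members Φ) :
    (∏ᶜ fun i : J.1 => T i) ⊗ (∏ᶜ fun i : J.1 => T' i) ⟶ ∏ᶜ fun i : J.1 => T'' i :=
  Pi.lift fun i => (Pi.π _ i ⊗ₘ Pi.π _ i) ≫ m i

lemma restrictProd_prodMul_fromProd (c'' : Cocone (prodDiagram Φ T''))
    (m : ∀ i, T i ⊗ T' i ⟶ T'' i) {J K : Members Φ} (h : K ≤ J) :
    (restrictProd T h ⊗ₘ restrictProd T' h) ≫ prodMul m K ≫ fromProd c'' K =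
      prodMul m J ≫ fromProd c'' J := by
  rw [← restrictProd_fromProd c'' h, ← Category.assoc, ← Category.assoc]
  exact congrArg (· ≫ _) (Pi.hom_ext _ _ fun i => by simp [restrictProd, prodMul])

variable
  [∀ X : V, PreservesColimitsOfShape (Members Φ)ᵒᵖ (tensorLeft X)]
  [∀ X : V, PreservesColimitsOfShape (Members Φ)ᵒᵖ (tensorRight X)]

instance preservesColimit₂_curriedTensor (F G : (Members Φ)ᵒᵖ ⥤ V) :
    PreservesColimit₂ F G (curriedTensor V) :=
  have (X : V) : PreservesColimit G ((curriedTensor V).obj X) :=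
    inferInstanceAs (PreservesColimit G (tensorLeft X))
  have (X : V) : PreservesColimit F ((curriedTensor V).flip.obj X) :=
    inferInstanceAs (PreservesColimit F (tensorRight X))
  inferInstance

include hc hc' in
-- As `⊗` preserves these colimits in each variable, the tensor product is a colimit over pairs of
-- members. The index category is filtered, so the diagonal stages `J = J'` already compute it.
lemma tensor_hom_ext {Z : V} {f g : c.pt ⊗ c'.pt ⟶ Z}
    (h : ∀ J, (fromProd c J ⊗ₘ fromProd c' J) ≫ f = (fromProd c J ⊗ₘ fromProd c' J) ≫ g) :
    f = g :=
  (hc.tensor hc').hom_ext fun J => h J.unop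

include hc hc' hc'' in
lemma tensor₃_hom_ext {Z : V} {f g : c.pt ⊗ c'.pt ⊗ c''.pt ⟶ Z}
    (h : ∀ J, (fromProd c J ⊗ₘ fromProd c' J ⊗ₘ fromProd c'' J) ≫ f =
      (fromProd c J ⊗ₘ fromProd c' J ⊗ₘ fromProd c'' J) ≫ g) :
    f = g :=
  (hc.tensor (hc'.tensor hc'')).hom_ext fun J => h J.unop

/-- The bilinear operation on filtered colimits of products induced by a family of bilinear
operations. -/
def colimMul (c'' : Cocone (prodDiagram Φ T'')) (m : ∀ i, T i ⊗ T' i ⟶ T'' i) :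
    c.pt ⊗ c'.pt ⟶ c''.pt :=
  (hc.tensor hc').desc (Cocone.mk c''.pt
    { app := fun J => prodMul m J.unop ≫ fromProd c'' J.unop
      naturality := fun J K h => by
        exact (restrictProd_prodMul_fromProd c'' m (leOfHom h.unop)).trans
          (Category.comp_id _).symm })

lemma fromProd_tensor_colimMul (c'' : Cocone (prodDiagram Φ T'')) (m : ∀ i, T i ⊗ T' i ⟶ T'' i)
    (J : Members Φ) :
    (fromProd c J ⊗ₘ fromProd c' J) ≫ colimMul hc hc' c'' m = prodMul m J ≫ fromProd c'' J :=
  (hc.tensor hc').fac _ (op J)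

end Tensor

end

end ProdDiagram

/-! ### The enrichment of the filter product -/

section Enrichment

variable (V : Type u₃) [Category.{v₃} V] [MonoidalCategory V] {I : Type w} {Φ : Filter I}
  [∀ J : Set I, HasProductsOfShape J V]

section

variable {C : Type u₁} [Category.{v₁} C] [EnrichedOrdinaryCategory V C]

/-- The composition on products of mapping objects. -/
abbrev prodComp (X Y Z : I → C) (J : Members Φ) :
    (∏ᶜ fun i : J.1 => (X i ⟶[V] Y i)) ⊗ (∏ᶜ fun i : J.1 => (Y i ⟶[V] Z i)) ⟶
      ∏ᶜ fun i : J.1 => (X i ⟶[V] Z i) :=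
  prodMul (fun i => eComp V (X i) (Y i) (Z i)) J

lemma prod_id_comp (X Y : I → C) (J : Members Φ) :
    (λ_ _).inv ≫ Pi.lift (fun i : J.1 => eId V (X i)) ▷ _ ≫ prodComp V X X Y J = 𝟙 _ :=
  Pi.hom_ext _ _ fun i => by
    have h : (λ_ _).inv ≫ (eId V (X i) ⊗ₘ Pi.π (fun i : J.1 => (X i ⟶[V] Y i)) i) ≫
        eComp V (X i) (X i) (Y i) = Pi.π (fun i : J.1 => (X i ⟶[V] Y i)) i := by
      rw [tensorHom_def', Category.assoc, ← leftUnitor_inv_naturality_assoc, e_id_comp,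
        Category.comp_id]
    simpa [prodMul, ← tensorHom_id] using h

lemma prod_comp_id (X Y : I → C) (J : Members Φ) :
    (ρ_ _).inv ≫ _ ◁ Pi.lift (fun i : J.1 => eId V (Y i)) ≫ prodComp V X Y Y J = 𝟙 _ :=
  Pi.hom_ext _ _ fun i => by
    have h : (ρ_ _).inv ≫ (Pi.π (fun i : J.1 => (X i ⟶[V] Y i)) i ⊗ₘ eId V (Y i)) ≫
        eComp V (X i) (Y i) (Y i) = Pi.π (fun i : J.1 => (X i ⟶[V] Y i)) i := by
      rw [MonoidalCategory.tensorHom_def, Category.assoc, ← rightUnitor_inv_naturality_assoc,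
        e_comp_id, Category.comp_id]
    simpa [prodMul, ← id_tensorHom] using h

lemma prod_assoc (W X Y Z : I → C) (J : Members Φ) :
    (α_ _ _ _).inv ≫ prodComp V W X Y J ▷ _ ≫ prodComp V W Y Z J =
      _ ◁ prodComp V X Y Z J ≫ prodComp V W X Z J :=
  Pi.hom_ext _ _ fun i => by
    have h := congrArg ((Pi.π (fun i : J.1 => (W i ⟶[V] X i)) i ⊗ₘ
      Pi.π (fun i : J.1 => (X i ⟶[V] Y i)) i ⊗ₘ Pi.π (fun i : J.1 => (Y i ⟶[V] Z i)) i) ≫ ·)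
      (e_assoc V (W i) (X i) (Y i) (Z i))
    rw [associator_inv_naturality_assoc, ← tensorHom_id, tensorHom_comp_tensorHom_assoc,
      Category.comp_id, ← id_tensorHom, tensorHom_comp_tensorHom_assoc, Category.comp_id] at h
    simpa [prodMul, ← id_tensorHom, ← tensorHom_id] using h

end

variable [HasFilteredColimitsOfSize.{w, w} V]
  {M : Type u₁} [Category.{v₁} M] [HasInitial M] [HasTerminal M] [EnrichedOrdinaryCategory V M]

/-- The colimit cocone whose point is the mapping object of the filter product. -/
abbrev mapCocone (X Y : FilterProduct M Φ) :
    Cocone (prodDiagram Φ fun i => (X.as i ⟶[V] Y.as i)) :=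
  colimit.cocone _

/-- The cocone `mapCocone` is colimiting. -/
def mapCoconeIsColimit (X Y : FilterProduct M Φ) : IsColimit (mapCocone V X Y) :=
  colimit.isColimit _

/-- The identity of an object of the filter product, as a point of the mapping object. -/
def mapId (X : FilterProduct M Φ) : 𝟙_ V ⟶ (mapCocone V X X).pt :=
  Pi.lift (fun i : (⊤ : Members Φ).1 => eId V (X.as i)) ≫ fromProd (mapCocone V X X) ⊤

/-- The identity is defined at the largest member `⊤`, but can be read off at any stage, in
particular at the one where it is composed with something else. -/
lemma mapId_eq (X : FilterProduct M Φ) (J : Members Φ) :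
    mapId V X = Pi.lift (fun i : J.1 => eId V (X.as i)) ≫ fromProd (mapCocone V X X) J :=
  (lift_fromProd_of_le (mapCocone V X X) (le_top : J ≤ ⊤) fun i => eId V (X.as i)).symm

variable [∀ X : V, PreservesColimitsOfShape (Members Φ)ᵒᵖ (tensorLeft X)]
  [∀ X : V, PreservesColimitsOfShape (Members Φ)ᵒᵖ (tensorRight X)]

/-- The composition of the mapping objects of the filter product. -/
def mapComp (X Y Z : FilterProduct M Φ) :
    (mapCocone V X Y).pt ⊗ (mapCocone V Y Z).pt ⟶ (mapCocone V X Z).pt :=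
  colimMul (mapCoconeIsColimit V X Y) (mapCoconeIsColimit V Y Z) (mapCocone V X Z)
    fun i => eComp V (X.as i) (Y.as i) (Z.as i)

lemma fromProd_tensor_mapComp (X Y Z : FilterProduct M Φ) (J : Members Φ) :
    (fromProd (mapCocone V X Y) J ⊗ₘ fromProd (mapCocone V Y Z) J) ≫ mapComp V X Y Z =
      prodComp V X.as Y.as Z.as J ≫ fromProd (mapCocone V X Z) J :=
  fromProd_tensor_colimMul _ _ _ _ _

/-- After restriction to the stage `J`, and with the identity also read at `J`, this is the unit law
for the products, `prod_id_comp`. -/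
lemma mapId_mapComp (X Y : FilterProduct M Φ) :
    (λ_ _).inv ≫ mapId V X ▷ _ ≫ mapComp V X X Y = 𝟙 (mapCocone V X Y).pt :=
  hom_ext_of_le (mapCoconeIsColimit V X Y) ⊤ fun J _ => by
    rw [mapId_eq V X J, leftUnitor_inv_naturality_assoc, comp_whiskerRight, Category.assoc,
      whisker_exchange_assoc, ← tensorHom_def'_assoc, fromProd_tensor_mapComp,
      ← Category.assoc, ← Category.assoc, Category.assoc (λ_ _).inv, prod_id_comp,
      Category.id_comp, Category.comp_id]

lemma mapComp_mapId (X Y : FilterProduct M Φ) :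
    (ρ_ _).inv ≫ _ ◁ mapId V Y ≫ mapComp V X Y Y = 𝟙 (mapCocone V X Y).pt :=
  hom_ext_of_le (mapCoconeIsColimit V X Y) ⊤ fun J _ => by
    rw [mapId_eq V Y J, rightUnitor_inv_naturality_assoc, MonoidalCategory.whiskerLeft_comp,
      Category.assoc, ← whisker_exchange_assoc, ← MonoidalCategory.tensorHom_def_assoc,
      fromProd_tensor_mapComp,
      ← Category.assoc, ← Category.assoc, Category.assoc (ρ_ _).inv, prod_comp_id,
      Category.id_comp, Category.comp_id]

lemma mapComp_assoc (W X Y Z : FilterProduct M Φ) :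
    (α_ _ _ _).inv ≫ mapComp V W X Y ▷ _ ≫ mapComp V W Y Z =
      (mapCocone V W X).pt ◁ mapComp V X Y Z ≫ mapComp V W X Z :=
  tensor₃_hom_ext (mapCoconeIsColimit V W X) (mapCoconeIsColimit V X Y)
    (mapCoconeIsColimit V Y Z) fun J => by
    rw [associator_inv_naturality_assoc, ← tensorHom_id, tensorHom_comp_tensorHom_assoc,
      fromProd_tensor_mapComp, Category.comp_id, ← id_tensorHom, tensorHom_comp_tensorHom_assoc,
      fromProd_tensor_mapComp, Category.comp_id, ← whiskerRight_comp_tensorHom_assoc,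
      ← whiskerLeft_comp_tensorHom_assoc, fromProd_tensor_mapComp, fromProd_tensor_mapComp]
    simp only [← Category.assoc]
    congr 1
    simpa only [Category.assoc] using prod_assoc V W.as X.as Y.as Z.as J

variable [HasBinaryProducts M] [HasStrictInitialObjects M] [IsFinitelyPresentable.{w} (𝟙_ V)]

/-- The enrichment of the filter product induced by an enrichment of the factors. -/
@[reducible]
def filterProductEnrichment : EnrichedOrdinaryCategory V (FilterProduct M Φ) where
  Hom X Y := (mapCocone V X Y).pt
  id X := mapId V X
  comp X Y Z := mapComp V X Y Z
  id_comp X Y := mapId_mapComp V X Y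
  comp_id X Y := mapComp_mapId V X Y
  assoc W X Y Z := mapComp_assoc V W X Y Z
  homEquiv {X Y} := homEquivOfCompact (mapCoconeIsColimit V X Y) fun _ => eHomEquiv V
  homEquiv_id X := by
    rw [← homOfFamily_id X ⊤]
    refine (homEquivOfCompact_homOfFamily _ _ _).trans ?_
    simp only [eHomEquiv_id]
    rfl
  homEquiv_comp {X Y Z} φ ψ := by
    obtain ⟨J₁, h₁⟩ := exists_homOfFamily_eq φ
    obtain ⟨J₂, h₂⟩ := exists_homOfFamily_eq ψ
    -- Both morphisms are represented over one common member, where composition is componentwise and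
    -- the claim is `eHomEquiv_comp` at each index.
    obtain ⟨f, rfl⟩ := h₁ (J₁ ⊓ J₂) inf_le_left
    obtain ⟨g, rfl⟩ := h₂ (J₁ ⊓ J₂) inf_le_right
    rw [homOfFamily_comp, homEquivOfCompact_homOfFamily, homEquivOfCompact_homOfFamily,
      homEquivOfCompact_homOfFamily]
    change _ = (λ_ _).inv ≫ _ ≫ mapComp V X Y Z
    rw [← tensorHom_comp_tensorHom_assoc, fromProd_tensor_mapComp, ← Category.assoc,
      ← Category.assoc, Category.assoc (λ_ _).inv]
    refine congrArg (· ≫ _) (Pi.hom_ext _ _ fun i => ?_)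
    simp [prodMul, eHomEquiv_comp]

lemma isInducedEnrichment_filterProductEnrichment :
    letI := filterProductEnrichment V (M := M) (Φ := Φ)
    IsInducedEnrichment V (M := M) (Φ := Φ) fun X Y => (mapCocone V ⟨X⟩ ⟨Y⟩).ι :=
  letI := filterProductEnrichment V (M := M) (Φ := Φ)
  { isColimit X Y := ⟨mapCoconeIsColimit V ⟨X⟩ ⟨Y⟩⟩
    homEquiv_eq {X Y _} f := homEquivOfCompact_homOfFamily (X := ⟨X⟩) (Y := ⟨Y⟩)
      (mapCoconeIsColimit V ⟨X⟩ ⟨Y⟩) (fun _ => eHomEquiv V) f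
    id_eq _ := rfl
    comp_eq X Y Z J := fromProd_tensor_mapComp V ⟨X⟩ ⟨Y⟩ ⟨Z⟩ J }

end Enrichment

/-! ### Whiskering and enriched adjunctions for induced enrichments -/

section ProdWhisker

variable (V : Type u₃) [Category.{v₃} V] [MonoidalCategory V] {I : Type w} {Φ : Filter I}
  [∀ J : Set I, HasProductsOfShape J V]
  {C : Type u₁} [Category.{v₁} C] [EnrichedOrdinaryCategory V C]

/-- The componentwise precomposition on products of mapping objects. -/
def prodWhiskerRight {J : Members Φ} {X X' : I → C} (f : ∀ i : J.1, X i ⟶ X' i) (Y : I → C) :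
    (∏ᶜ fun i : J.1 => (X' i ⟶[V] Y i)) ⟶ ∏ᶜ fun i : J.1 => (X i ⟶[V] Y i) :=
  Pi.lift fun i => Pi.π _ i ≫ eHomWhiskerRight V (f i) (Y i)

/-- The componentwise postcomposition on products of mapping objects. -/
def prodWhiskerLeft {J : Members Φ} (X : I → C) {Y Y' : I → C} (g : ∀ i : J.1, Y i ⟶ Y' i) :
    (∏ᶜ fun i : J.1 => (X i ⟶[V] Y i)) ⟶ ∏ᶜ fun i : J.1 => (X i ⟶[V] Y' i) :=
  Pi.lift fun i => Pi.π _ i ≫ eHomWhiskerLeft V (X i) (g i)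

@[simp]
lemma prodWhiskerRight_π {J : Members Φ} {X X' : I → C} (f : ∀ i : J.1, X i ⟶ X' i) (Y : I → C)
    (i : J.1) : prodWhiskerRight V f Y ≫ Pi.π _ i = Pi.π _ i ≫ eHomWhiskerRight V (f i) (Y i) :=
  limit.lift_π _ _

@[simp]
lemma prodWhiskerLeft_π {J : Members Φ} (X : I → C) {Y Y' : I → C} (g : ∀ i : J.1, Y i ⟶ Y' i)
    (i : J.1) : prodWhiskerLeft V X g ≫ Pi.π _ i = Pi.π _ i ≫ eHomWhiskerLeft V (X i) (g i) :=
  limit.lift_π _ _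

end ProdWhisker

section Adjunction

variable {M : Type u₁} [Category.{v₁} M]
  [HasInitial M] [HasTerminal M] [HasBinaryProducts M] [HasStrictInitialObjects M]
  {N : Type u₂} [Category.{v₂} N]
  [HasInitial N] [HasTerminal N] [HasBinaryProducts N] [HasStrictInitialObjects N]
  {I : Type w} {Φ : Filter I} {F : M ⥤ N} {G : N ⥤ M} (adj : F ⊣ G)

lemma mapAdjunction_unit_app_eq (X : FilterProduct M Φ) (J : Members Φ) :
    (mapAdjunction Φ adj).unit.app X =
      homOfFamily (Y := (mapFunctor Φ G).obj ((mapFunctor Φ F).obj X))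
        fun i : J.1 => adj.unit.app (X.as i) :=
  homOfApp_eq_homOfFamily (Y := (mapFunctor Φ G).obj ((mapFunctor Φ F).obj X))
    (fun i => adj.unit.app (X.as i)) J

lemma mapAdjunction_counit_app_eq (X : FilterProduct N Φ) (J : Members Φ) :
    (mapAdjunction Φ adj).counit.app X =
      homOfFamily (X := (mapFunctor Φ F).obj ((mapFunctor Φ G).obj X))
        fun i : J.1 => adj.counit.app (X.as i) :=
  homOfApp_eq_homOfFamily (X := (mapFunctor Φ F).obj ((mapFunctor Φ G).obj X))
    (fun i => adj.counit.app (X.as i)) J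

end Adjunction

/-! ### Computation in an induced enrichment through its structure morphisms. -/

section Induced

variable {V : Type u₃} [Category.{v₃} V] [MonoidalCategory V] {I : Type w} {Φ : Filter I}
  [∀ J : Set I, HasProductsOfShape J V]
  {M : Type u₁} [Category.{v₁} M] [HasInitial M] [HasTerminal M] [HasBinaryProducts M]
  [EnrichedOrdinaryCategory V M]
  [EnrichedOrdinaryCategory V (FilterProduct M Φ)]
  {ι : ∀ X Y : I → M, mapDiagram V Φ X Y ⟶
    (Functor.const _).obj ((proj M Φ).obj X ⟶[V] (proj M Φ).obj Y)}

variable (ι) in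
/-- The structure morphisms of an induced enrichment, as a cocone. -/
def inducedCocone (X Y : FilterProduct M Φ) :
    Cocone (prodDiagram Φ fun i => (X.as i ⟶[V] Y.as i)) :=
  Cocone.mk (X ⟶[V] Y) (ι X.as Y.as)

variable (ι) in
/-- The structure morphism `∏_{i ∈ J} Map(X i, Y i) ⟶ Map(X, Y)` of an induced enrichment. -/
def inducedι (X Y : FilterProduct M Φ) (J : Members Φ) :
    (∏ᶜ fun i : J.1 => (X.as i ⟶[V] Y.as i)) ⟶ (X ⟶[V] Y) :=
  fromProd (inducedCocone ι X Y) J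

namespace IsInducedEnrichment

variable (h : IsInducedEnrichment V ι) {X Y Z : FilterProduct M Φ}

include h

/-- The cocone `inducedCocone` is colimiting. -/
def isColimitCocone (X Y : FilterProduct M Φ) : IsColimit (inducedCocone ι X Y) :=
  (h.isColimit X.as Y.as).some

lemma map_hom_ext (J₀ : Members Φ) {Z : V} {f g : (X ⟶[V] Y) ⟶ Z}
    (H : ∀ J ≤ J₀, inducedι ι X Y J ≫ f = inducedι ι X Y J ≫ g) : f = g :=
  hom_ext_of_le (h.isColimitCocone X Y) J₀ H

lemma eHomEquiv_homOfFamily {J : Members Φ} (f : ∀ i : J.1, X.as i ⟶ Y.as i) :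
    eHomEquiv V (homOfFamily f) = Pi.lift (fun i => eHomEquiv V (f i)) ≫ inducedι ι X Y J :=
  h.homEquiv_eq f

lemma eId_eq (J : Members Φ) :
    eId V X = Pi.lift (fun i : J.1 => eId V (X.as i)) ≫ inducedι ι X X J :=
  (h.id_eq X.as).trans (lift_fromProd_of_le (inducedCocone ι X X) (le_top : J ≤ ⊤)
    fun i => eId V (X.as i)).symm

lemma tensor_eComp (X Y Z : FilterProduct M Φ) (J : Members Φ) :
    (inducedι ι X Y J ⊗ₘ inducedι ι Y Z J) ≫ eComp V X Y Z =
      prodComp V X.as Y.as Z.as J ≫ inducedι ι X Z J :=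
  h.comp_eq X.as Y.as Z.as J

/-- Precomposition with `f` is composition with the point that names `f`. For a germ that point
comes from the stage `J`, so `tensor_eComp` moves the whole computation into the product over `J`.
-/
lemma inducedι_eHomWhiskerRight {J : Members Φ} (f : ∀ i : J.1, X.as i ⟶ Y.as i)
    (Z : FilterProduct M Φ) :
    inducedι ι Y Z J ≫ eHomWhiskerRight V (homOfFamily f) Z =
      prodWhiskerRight V f Z.as ≫ inducedι ι X Z J := by
  dsimp only [eHomWhiskerRight]
  rw [h.eHomEquiv_homOfFamily, leftUnitor_inv_naturality_assoc, comp_whiskerRight, Category.assoc,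
    whisker_exchange_assoc, ← tensorHom_def'_assoc, h.tensor_eComp, ← Category.assoc,
    ← Category.assoc, Category.assoc (λ_ _).inv]
  refine congrArg (· ≫ _) (Pi.hom_ext _ _ fun i => ?_)
  have e : (λ_ _).inv ≫ (eHomEquiv V (f i) ⊗ₘ Pi.π (fun i : J.1 => (Y.as i ⟶[V] Z.as i)) i) ≫
      eComp V (X.as i) (Y.as i) (Z.as i) =
      Pi.π (fun i : J.1 => (Y.as i ⟶[V] Z.as i)) i ≫ eHomWhiskerRight V (f i) (Z.as i) := by
    rw [tensorHom_def', Category.assoc, ← leftUnitor_inv_naturality_assoc]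
    rfl
  simpa [prodMul, ← tensorHom_id] using e

lemma inducedι_eHomWhiskerLeft {J : Members Φ} (X : FilterProduct M Φ)
    (g : ∀ i : J.1, Y.as i ⟶ Z.as i) :
    inducedι ι X Y J ≫ eHomWhiskerLeft V X (homOfFamily g) =
      prodWhiskerLeft V X.as g ≫ inducedι ι X Z J := by
  dsimp only [eHomWhiskerLeft]
  rw [h.eHomEquiv_homOfFamily, rightUnitor_inv_naturality_assoc, MonoidalCategory.whiskerLeft_comp,
    Category.assoc, ← whisker_exchange_assoc, ← MonoidalCategory.tensorHom_def_assoc,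
    h.tensor_eComp, ← Category.assoc, ← Category.assoc, Category.assoc (ρ_ _).inv]
  refine congrArg (· ≫ _) (Pi.hom_ext _ _ fun i => ?_)
  have e : (ρ_ _).inv ≫ (Pi.π (fun i : J.1 => (X.as i ⟶[V] Y.as i)) i ⊗ₘ eHomEquiv V (g i)) ≫
      eComp V (X.as i) (Y.as i) (Z.as i) =
      Pi.π (fun i : J.1 => (X.as i ⟶[V] Y.as i)) i ≫ eHomWhiskerLeft V (X.as i) (g i) := by
    rw [MonoidalCategory.tensorHom_def, Category.assoc, ← rightUnitor_inv_naturality_assoc]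
    rfl
  simpa [prodMul, ← id_tensorHom] using e

end IsInducedEnrichment

variable (h : IsInducedEnrichment V ι) [HasStrictInitialObjects M]
  {N : Type u₂} [Category.{v₂} N] [HasInitial N] [HasTerminal N] [HasBinaryProducts N]
  [HasStrictInitialObjects N] [EnrichedOrdinaryCategory V N]
  [EnrichedOrdinaryCategory V (FilterProduct N Φ)]
  {ι' : ∀ X Y : I → N, mapDiagram V Φ X Y ⟶
    (Functor.const _).obj ((proj N Φ).obj X ⟶[V] (proj N Φ).obj Y)}
  (h' : IsInducedEnrichment V ι') {F : M ⥤ N} {G : N ⥤ M}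

variable (ι') in
/-- The action on mapping objects of the functor between filter products induced by a
`V`-functor. -/
def enrichedMapHom (S : EnrichedStructure V F) (X Y : FilterProduct M Φ) :
    (X ⟶[V] Y) ⟶ ((mapFunctor Φ F).obj X ⟶[V] (mapFunctor Φ F).obj Y) :=
  colimMapOfFamily (h.isColimitCocone X Y)
    (inducedCocone ι' ((mapFunctor Φ F).obj X) ((mapFunctor Φ F).obj Y))
    fun i => S.map (X.as i) (Y.as i)

lemma inducedι_enrichedMapHom (S : EnrichedStructure V F) (X Y : FilterProduct M Φ)
    (J : Members Φ) :
    inducedι ι X Y J ≫ enrichedMapHom h ι' S X Y =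
      prodMap (fun i => S.map (X.as i) (Y.as i)) J ≫
        inducedι ι' ((mapFunctor Φ F).obj X) ((mapFunctor Φ F).obj Y) J :=
  fromProd_colimMapOfFamily _ _ _ _

variable [∀ X : V, PreservesColimitsOfShape (Members Φ)ᵒᵖ (tensorLeft X)]
  [∀ X : V, PreservesColimitsOfShape (Members Φ)ᵒᵖ (tensorRight X)]

include h' in
/-- The functor between filter products induced by a `V`-functor is a `V`-functor. -/
def mapEnrichedStructure (S : EnrichedStructure V F) : EnrichedStructure V (mapFunctor Φ F) where
  map := enrichedMapHom h ι' S
  map_id X := by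
    rw [h.eId_eq ⊤, h'.eId_eq ⊤, Category.assoc, inducedι_enrichedMapHom, ← Category.assoc]
    refine congrArg (· ≫ _) (Pi.hom_ext _ _ fun i => ?_)
    simp [prodMap, S.map_id]
  map_comp X Y Z := tensor_hom_ext (h.isColimitCocone X Y) (h.isColimitCocone Y Z) fun J => by
    change (inducedι ι X Y J ⊗ₘ inducedι ι Y Z J) ≫ _ = (inducedι ι X Y J ⊗ₘ inducedι ι Y Z J) ≫ _
    rw [reassoc_of% h.tensor_eComp, inducedι_enrichedMapHom, tensorHom_comp_tensorHom_assoc,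
      inducedι_enrichedMapHom, inducedι_enrichedMapHom, ← tensorHom_comp_tensorHom_assoc,
      h'.tensor_eComp, ← Category.assoc, ← Category.assoc]
    refine congrArg (· ≫ _) (Pi.hom_ext _ _ fun i => ?_)
    simp [prodMap, prodMul, S.map_comp]
  homEquiv_map {X Y} φ := by
    obtain ⟨J, hJ⟩ := exists_homOfFamily_eq φ
    obtain ⟨f, rfl⟩ := hJ J le_rfl
    rw [mapFunctor_map_homOfFamily, h.eHomEquiv_homOfFamily, h'.eHomEquiv_homOfFamily,
      Category.assoc, inducedι_enrichedMapHom, ← Category.assoc]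
    refine congrArg (· ≫ _) (Pi.hom_ext _ _ fun i => ?_)
    simp [prodMap, S.homEquiv_map]

/-- The adjunction between filter products induced by a `V`-enriched adjunction is
`V`-enriched. -/
def mapEnrichedAdjunction {adj : F ⊣ G} (S : EnrichedAdjunction V adj) :
    EnrichedAdjunction V (mapAdjunction Φ adj) where
  left := mapEnrichedStructure h h' S.left
  right := mapEnrichedStructure h' h S.right
  unit_naturality X Y := h.map_hom_ext ⊤ fun J _ => by
    dsimp only [mapEnrichedStructure]
    rw [reassoc_of% inducedι_enrichedMapHom, reassoc_of% inducedι_enrichedMapHom,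
      mapAdjunction_unit_app_eq adj X J, mapAdjunction_unit_app_eq adj Y J,
      h.inducedι_eHomWhiskerLeft,
      h.inducedι_eHomWhiskerRight, ← Category.assoc, ← Category.assoc]
    refine congrArg (· ≫ _) (Pi.hom_ext _ _ fun i => ?_)
    simpa [prodMap] using congrArg (Pi.π (fun i : J.1 => (X.as i ⟶[V] Y.as i)) i ≫ ·)
      (S.unit_naturality (X.as i) (Y.as i))
  counit_naturality X Y := h'.map_hom_ext ⊤ fun J _ => by
    dsimp only [mapEnrichedStructure]
    rw [reassoc_of% inducedι_enrichedMapHom, reassoc_of% inducedι_enrichedMapHom,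
      mapAdjunction_counit_app_eq adj X J, mapAdjunction_counit_app_eq adj Y J,
      h'.inducedι_eHomWhiskerLeft,
      h'.inducedι_eHomWhiskerRight, ← Category.assoc, ← Category.assoc]
    refine congrArg (· ≫ _) (Pi.hom_ext _ _ fun i => ?_)
    simpa [prodMap] using congrArg (Pi.π (fun i : J.1 => (X.as i ⟶[V] Y.as i)) i ≫ ·)
      (S.counit_naturality (X.as i) (Y.as i))

end Induced

/-! ### Gap morphisms to pullbacks of filtered colimits of products -/

section Gap

/-- Exactness says that `colim` preserves pullbacks; the result is carried from the chosen colimits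
to the given ones along the comparison isomorphisms. -/
lemma isPullback_colimit {D : Type*} [Category* D] {V : Type*} [Category* V]
    [HasPullbacks V] [HasColimitsOfShape D V] [HasFiniteLimits V] [HasExactColimitsOfShape D V]
    {F₁ F₂ F₃ F₄ : D ⥤ V} {a : F₁ ⟶ F₂} {b : F₁ ⟶ F₃} {f : F₂ ⟶ F₄} {g : F₃ ⟶ F₄}
    (sq : IsPullback a b f g) {c₁ : Cocone F₁} {c₂ : Cocone F₂} {c₃ : Cocone F₃} {c₄ : Cocone F₄}
    (h₁ : IsColimit c₁) (h₂ : IsColimit c₂) (h₃ : IsColimit c₃) (h₄ : IsColimit c₄) :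
    IsPullback (h₁.map c₂ a) (h₁.map c₃ b) (h₂.map c₄ f) (h₃.map c₄ g) := by
  have hom_ext {F F' : D ⥤ V} {c : Cocone F} {c' : Cocone F'} (h : IsColimit c)
      (h' : IsColimit c') (α : F ⟶ F') : colim.map α ≫
        ((colimit.isColimit F').coconePointUniqueUpToIso h').hom =
      ((colimit.isColimit F).coconePointUniqueUpToIso h).hom ≫ h.map c' α :=
    colimit.hom_ext fun j => by simp
  exact (sq.map colim).of_iso ((colimit.isColimit _).coconePointUniqueUpToIso h₁)
    ((colimit.isColimit _).coconePointUniqueUpToIso h₂)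
    ((colimit.isColimit _).coconePointUniqueUpToIso h₃)
    ((colimit.isColimit _).coconePointUniqueUpToIso h₄)
    (hom_ext _ _ _) (hom_ext _ _ _) (hom_ext _ _ _) (hom_ext _ _ _)

variable {V : Type u₃} [Category.{v₃} V] {I : Type w} {Φ : Filter I}
  [∀ J : Set I, HasProductsOfShape J V] {T T' T₁ T₂ T₃ T₄ : I → V} {J₀ : Members Φ}

/-- The morphism of products over `J ≤ J₀` induced by a family of morphisms over `J₀`. -/
def prodMapOfLE {J : Members Φ} (h : J ≤ J₀) (f : ∀ i : J₀.1, T i ⟶ T' i) :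
    (∏ᶜ fun i : J.1 => T i) ⟶ ∏ᶜ fun i : J.1 => T' i :=
  Pi.lift fun i => Pi.π _ i ≫ f ⟨i.1, h i.2⟩

@[simp]
lemma prodMapOfLE_π {J : Members Φ} (h : J ≤ J₀) (f : ∀ i : J₀.1, T i ⟶ T' i) (i : J.1) :
    prodMapOfLE h f ≫ Pi.π _ i = Pi.π _ i ≫ f ⟨i.1, h i.2⟩ :=
  limit.lift_π _ _

lemma prodMapOfLE_comp {J : Members Φ} (h : J ≤ J₀) (f : ∀ i : J₀.1, T₁ i ⟶ T₂ i)
    (g : ∀ i : J₀.1, T₂ i ⟶ T₃ i) :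
    prodMapOfLE h f ≫ prodMapOfLE h g = prodMapOfLE h fun i => f i ≫ g i :=
  Pi.hom_ext _ _ fun i => by simp [reassoc_of% prodMapOfLE_π]

lemma restrictProd_prodMapOfLE {J K : Members Φ} (hJ : J ≤ J₀) (hK : K ≤ J₀) (h : K ≤ J)
    (f : ∀ i : J₀.1, T i ⟶ T' i) :
    restrictProd T h ≫ prodMapOfLE hK f = prodMapOfLE hJ f ≫ restrictProd T' h :=
  Pi.hom_ext _ _ fun i => by simp [restrictProd, reassoc_of% limit.lift_π]

lemma isPullback_prodMapOfLE {J : Members Φ} (h : J ≤ J₀)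
    {a : ∀ i : J₀.1, T₁ i ⟶ T₂ i} {b : ∀ i : J₀.1, T₁ i ⟶ T₃ i}
    {f : ∀ i : J₀.1, T₂ i ⟶ T₄ i} {g : ∀ i : J₀.1, T₃ i ⟶ T₄ i}
    (sq : ∀ i, IsPullback (a i) (b i) (f i) (g i)) :
    IsPullback (prodMapOfLE h a) (prodMapOfLE h b) (prodMapOfLE h f) (prodMapOfLE h g) where
  w := Pi.hom_ext _ _ fun i => by
    simp [(sq _).w, reassoc_of% prodMapOfLE_π]
  isLimit' := by
    have H (s : PullbackCone (prodMapOfLE h f) (prodMapOfLE h g)) (i : J.1) :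
        (s.fst ≫ Pi.π _ i) ≫ f ⟨i.1, h i.2⟩ = (s.snd ≫ Pi.π _ i) ≫ g ⟨i.1, h i.2⟩ := by
      simpa using congrArg (· ≫ Pi.π _ i) s.condition
    refine ⟨PullbackCone.IsLimit.mk _ (fun s => Pi.lift fun i => (sq ⟨i.1, h i.2⟩).lift _ _ (H s i))
      (fun s => Pi.hom_ext _ _ fun i => ?_) (fun s => Pi.hom_ext _ _ fun i => ?_)
      fun s m h₁ h₂ => Pi.hom_ext _ _ fun i => (sq ⟨i.1, h i.2⟩).hom_ext ?_ ?_⟩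
    · simp
    · simp
    · simp [← h₁]
    · simp [← h₂]

variable (J₀) in
/-- The diagram of products over the members of the filter below `J₀`. -/
abbrev prodDiagramUnder (T : I → V) : Under (op J₀) ⥤ V := Under.forget (op J₀) ⋙ prodDiagram Φ T

/-- The transformation of diagrams of products induced by a family of morphisms over `J₀`. -/
def prodNatTrans (f : ∀ i : J₀.1, T i ⟶ T' i) : prodDiagramUnder J₀ T ⟶ prodDiagramUnder J₀ T' where
  app J := prodMapOfLE (leOfHom J.hom.unop) f
  naturality J K k :=
    restrictProd_prodMapOfLE (leOfHom J.hom.unop) (leOfHom K.hom.unop) (leOfHom k.right.unop) f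

lemma isPullback_prodNatTrans
    {a : ∀ i : J₀.1, T₁ i ⟶ T₂ i} {b : ∀ i : J₀.1, T₁ i ⟶ T₃ i}
    {f : ∀ i : J₀.1, T₂ i ⟶ T₄ i} {g : ∀ i : J₀.1, T₃ i ⟶ T₄ i}
    (sq : ∀ i, IsPullback (a i) (b i) (f i) (g i)) :
    IsPullback (prodNatTrans a) (prodNatTrans b) (prodNatTrans f) (prodNatTrans g) :=
  IsPullback.of_forall_isPullback_app fun J => isPullback_prodMapOfLE (leOfHom J.hom.unop) sq

/-- A product of morphisms is the induced morphism between limits over a discrete category, to which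
stability of `S` under products applies. -/
lemma prodMapOfLE_mem (S : MorphismProperty V) [∀ J : Set I, S.IsStableUnderProductsOfShape J]
    {J : Members Φ} (h : J ≤ J₀) {f : ∀ i : J₀.1, T i ⟶ T' i} (hf : ∀ i, S (f i)) :
    S (prodMapOfLE h f) :=
  MorphismProperty.IsStableUnderLimitsOfShape.condition
    (W := S) (J := Discrete J.1) _ _ _ _ (limit.isLimit _) (limit.isLimit _)
    (Discrete.natTrans (F := Discrete.functor fun i : J.1 => T i)
      (G := Discrete.functor fun i : J.1 => T' i) fun i => f ⟨i.as.1, h i.as.2⟩) (fun _ => hf _) _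
    (fun i => prodMapOfLE_π h f i.as)

/-- The restriction of a cocone to the members of the filter below `J₀` is colimiting. -/
def isColimitWhiskerUnder {c : Cocone (prodDiagram Φ T)} (hc : IsColimit c) :
    IsColimit (c.whisker (Under.forget (op J₀))) :=
  (Functor.Final.isColimitWhiskerEquiv _ _).symm hc

/-- A family over `J₀` induces a transformation only below `J₀`. This recognizes a given morphism of
the full colimits as the colimit of that transformation. -/
lemma isColimitMap_prodNatTrans {c : Cocone (prodDiagram Φ T)} (hc : IsColimit c)
    {c' : Cocone (prodDiagram Φ T')} {f : ∀ i : J₀.1, T i ⟶ T' i} {φ : c.pt ⟶ c'.pt}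
    (h : ∀ J (hJ : J ≤ J₀), fromProd c J ≫ φ = prodMapOfLE hJ f ≫ fromProd c' J) :
    (isColimitWhiskerUnder hc).map (c'.whisker (Under.forget (op J₀))) (prodNatTrans f) = φ :=
  (isColimitWhiskerUnder hc).hom_ext fun J =>
    (IsColimit.ι_map _ _ _ _).trans (h J.right.unop (leOfHom J.hom.unop)).symm

variable [HasFilteredColimitsOfSize.{w, w} V] [AB5OfSize.{w, w} V] [HasFiniteLimits V]
  (S : MorphismProperty V) [S.RespectsIso] [∀ J : Set I, S.IsStableUnderProductsOfShape J]
  [MorphismProperty.IsStableUnderFilteredColimits.{w, w} S]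

/-- If the gap morphisms of a family of commutative squares over `J₀` belong to `S`, then so does
the gap morphism of the induced square of filtered colimits of products. -/
lemma pullback_lift_mem
    {c₁ : Cocone (prodDiagram Φ T₁)} {c₂ : Cocone (prodDiagram Φ T₂)}
    {c₃ : Cocone (prodDiagram Φ T₃)} {c₄ : Cocone (prodDiagram Φ T₄)}
    (h₁ : IsColimit c₁) (h₂ : IsColimit c₂) (h₃ : IsColimit c₃) (h₄ : IsColimit c₄)
    {a : ∀ i : J₀.1, T₁ i ⟶ T₂ i} {b : ∀ i : J₀.1, T₁ i ⟶ T₃ i}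
    {f : ∀ i : J₀.1, T₂ i ⟶ T₄ i} {g : ∀ i : J₀.1, T₃ i ⟶ T₄ i}
    {w : ∀ i, a i ≫ f i = b i ≫ g i}
    (hS : ∀ i, S (pullback.lift (a i) (b i) (w i)))
    {a' : c₁.pt ⟶ c₂.pt} {b' : c₁.pt ⟶ c₃.pt} {f' : c₂.pt ⟶ c₄.pt} {g' : c₃.pt ⟶ c₄.pt}
    (ha : ∀ J (hJ : J ≤ J₀), fromProd c₁ J ≫ a' = prodMapOfLE hJ a ≫ fromProd c₂ J)
    (hb : ∀ J (hJ : J ≤ J₀), fromProd c₁ J ≫ b' = prodMapOfLE hJ b ≫ fromProd c₃ J)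
    (hf : ∀ J (hJ : J ≤ J₀), fromProd c₂ J ≫ f' = prodMapOfLE hJ f ≫ fromProd c₄ J)
    (hg : ∀ J (hJ : J ≤ J₀), fromProd c₃ J ≫ g' = prodMapOfLE hJ g ≫ fromProd c₄ J)
    (w' : a' ≫ f' = b' ≫ g') :
    S (pullback.lift a' b' w') := by
  -- Componentwise pullbacks exist only over `J₀`, whereas `prodDiagram` wants a family over all of
  -- `I`; at the other indices `T₁ i` is an arbitrary value.
  have hP (i : I) : ∃ (P : V) (p : i ∈ J₀.1 → (P ⟶ T₂ i)) (q : i ∈ J₀.1 → (P ⟶ T₃ i)),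
      ∀ hi, IsPullback (p hi) (q hi) (f ⟨i, hi⟩) (g ⟨i, hi⟩) := by
    by_cases hi : i ∈ J₀.1
    · exact ⟨pullback (f ⟨i, hi⟩) (g ⟨i, hi⟩), fun _ => pullback.fst _ _,
        fun _ => pullback.snd _ _, fun _ => IsPullback.of_hasPullback _ _⟩
    · exact ⟨T₁ i, fun h => (hi h).elim, fun h => (hi h).elim, fun h => (hi h).elim⟩
  choose P p q sq using hP
  let p' (i : J₀.1) : P i ⟶ T₂ i := p i.1 i.2
  let q' (i : J₀.1) : P i ⟶ T₃ i := q i.1 i.2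
  have sq' (i : J₀.1) : IsPullback (p' i) (q' i) (f i) (g i) := sq i.1 i.2
  let l (i : J₀.1) : T₁ i ⟶ P i := (sq' i).lift (a i) (b i) (w i)
  have hl (i : J₀.1) : S (l i) := by
    have : l i = pullback.lift (a i) (b i) (w i) ≫ (sq' i).isoPullback.inv :=
      (sq' i).hom_ext
        (by rw [Category.assoc, IsPullback.isoPullback_inv_fst, pullback.lift_fst,
          IsPullback.lift_fst])
        (by rw [Category.assoc, IsPullback.isoPullback_inv_snd, pullback.lift_snd,
          IsPullback.lift_snd])
    rw [this]
    exact MorphismProperty.RespectsIso.postcomp S _ _ (hS i)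
  let cP := colimit.cocone (prodDiagram Φ P)
  have hcP : IsColimit cP := colimit.isColimit _
  have SQ := isPullback_colimit (isPullback_prodNatTrans sq') (isColimitWhiskerUnder hcP)
    (isColimitWhiskerUnder h₂) (isColimitWhiskerUnder h₃) (isColimitWhiskerUnder h₄)
  rw [isColimitMap_prodNatTrans h₂ hf, isColimitMap_prodNatTrans h₃ hg] at SQ
  -- The colimit of the products of the gap morphisms `l i`. It lies in `S` by the stability
  -- hypotheses, and `e` identifies it with the gap morphism of the colimit square up to the
  -- isomorphism given by `SQ`.
  let L := (isColimitWhiskerUnder h₁).map (cP.whisker (Under.forget (op J₀))) (prodNatTrans l)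
  have hL : S L := MorphismProperty.IsStableUnderColimitsOfShape.condition (W := S) _ _ _ _
    (isColimitWhiskerUnder h₁) (isColimitWhiskerUnder hcP) (prodNatTrans l)
    (fun J => prodMapOfLE_mem S (leOfHom J.hom.unop) hl) L (fun J => IsColimit.ι_map _ _ _ _)
  have e : pullback.lift a' b' w' = L ≫ SQ.isoPullback.hom := by
    have hι {T' : I → V} (c' : Cocone (prodDiagram Φ T')) (r : ∀ i : J₀.1, P i ⟶ T' i)
        (s : ∀ i : J₀.1, T₁ i ⟶ T' i) (h : ∀ i, l i ≫ r i = s i) (s' : c₁.pt ⟶ c'.pt)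
        (hs : ∀ J (hJ : J ≤ J₀), fromProd c₁ J ≫ s' = prodMapOfLE hJ s ≫ fromProd c' J) :
        L ≫ (isColimitWhiskerUnder hcP).map (c'.whisker (Under.forget (op J₀)))
          (prodNatTrans r) = s' := by
      refine (isColimitWhiskerUnder h₁).hom_ext fun J => ?_
      have : prodNatTrans l ≫ prodNatTrans r = prodNatTrans s := by
        ext J
        obtain rfl : (fun i => l i ≫ r i) = s := funext h
        exact prodMapOfLE_comp (leOfHom J.hom.unop) l r
      rw [IsColimit.ι_map_assoc, IsColimit.ι_map, ← NatTrans.comp_app_assoc, this]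
      exact (hs J.right.unop (leOfHom J.hom.unop)).symm
    refine pullback.hom_ext ?_ ?_
    · rw [pullback.lift_fst, Category.assoc, SQ.isoPullback_hom_fst]
      exact (hι c₂ p' a (fun i => (sq' i).lift_fst _ _ _) a' ha).symm
    · rw [pullback.lift_snd, Category.assoc, SQ.isoPullback_hom_snd]
      exact (hι c₃ q' b (fun i => (sq' i).lift_snd _ _ _) b' hb).symm
  rw [e]
  exact MorphismProperty.RespectsIso.postcomp S _ _ hL

end Gap

/-! ### The compactly enriched structure of the filter product -/

section PullbackHom

variable {V : Type u₃} [Category.{v₃} V] [MonoidalCategory V] {I : Type w} {Φ : Filter I}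
  [∀ J : Set I, HasProductsOfShape J V]
  {M : Type u₁} [Category.{v₁} M] [HasInitial M] [HasTerminal M] [HasBinaryProducts M]
  [EnrichedOrdinaryCategory V M]
  [EnrichedOrdinaryCategory V (FilterProduct M Φ)]
  {ι : ∀ X Y : I → M, mapDiagram V Φ X Y ⟶
    (Functor.const _).obj ((proj M Φ).obj X ⟶[V] (proj M Φ).obj Y)}
  (h : IsInducedEnrichment V ι) {A B X Y : FilterProduct M Φ} {J₀ : Members Φ}

include h

/-- This is the right-hand side of the naturality axioms for tensors and cotensors, computed at a
stage `J` over which all morphisms involved are families. -/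
lemma IsInducedEnrichment.comp_lift_whisker {X X' Y Y' : FilterProduct M Φ} {J : Members Φ}
    {K K' : V} (k : K' ⟶ K) (φ : ∀ i : J.1, K ⟶ (X.as i ⟶[V] Y.as i))
    (f : ∀ i : J.1, X'.as i ⟶ X.as i) (g : ∀ i : J.1, Y.as i ⟶ Y'.as i) :
    k ≫ (Pi.lift φ ≫ inducedι ι X Y J) ≫ eHomWhiskerRight V (homOfFamily f) Y ≫
        eHomWhiskerLeft V X' (homOfFamily g) =
      Pi.lift (fun i => k ≫ φ i ≫ eHomWhiskerRight V (f i) (Y.as i) ≫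
        eHomWhiskerLeft V (X'.as i) (g i)) ≫ inducedι ι X' Y' J := by
  rw [Category.assoc, reassoc_of% h.inducedι_eHomWhiskerRight, h.inducedι_eHomWhiskerLeft]
  simp only [← Category.assoc]
  refine congrArg (· ≫ _) (Pi.hom_ext _ _ fun i => ?_)
  simp [reassoc_of% prodWhiskerRight_π]

variable [HasStrictInitialObjects M]

lemma IsInducedEnrichment.inducedι_eHomWhiskerRight_of_le {J : Members Φ} (hJ : J ≤ J₀)
    (f : ∀ i : J₀.1, A.as i ⟶ B.as i) (Y : FilterProduct M Φ) :
    inducedι ι B Y J ≫ eHomWhiskerRight V (homOfFamily f) Y =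
      prodMapOfLE (T := fun i => (B.as i ⟶[V] Y.as i)) (T' := fun i => (A.as i ⟶[V] Y.as i)) hJ
        (fun i => eHomWhiskerRight V (f i) (Y.as i)) ≫ inducedι ι A Y J := by
  rw [← homOfFamily_restrict hJ f]
  exact h.inducedι_eHomWhiskerRight _ _

lemma IsInducedEnrichment.inducedι_eHomWhiskerLeft_of_le {J : Members Φ} (hJ : J ≤ J₀)
    (A : FilterProduct M Φ) (g : ∀ i : J₀.1, Y.as i ⟶ X.as i) :
    inducedι ι A Y J ≫ eHomWhiskerLeft V A (homOfFamily g) =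
      prodMapOfLE (T := fun i => (A.as i ⟶[V] Y.as i)) (T' := fun i => (A.as i ⟶[V] X.as i)) hJ
        (fun i => eHomWhiskerLeft V (A.as i) (g i)) ≫ inducedι ι A X J := by
  rw [← homOfFamily_restrict hJ g]
  exact h.inducedι_eHomWhiskerLeft _ _

/-- If the pullback-homs of families of morphisms belong to `S`, then so does the pullback-hom of
the induced morphisms of the filter product. -/
lemma IsInducedEnrichment.pullbackHom_mem [HasFilteredColimitsOfSize.{w, w} V]
    [AB5OfSize.{w, w} V] [HasFiniteLimits V] (S : MorphismProperty V) [S.RespectsIso]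
    [∀ J : Set I, S.IsStableUnderProductsOfShape J]
    [MorphismProperty.IsStableUnderFilteredColimits.{w, w} S]
    (i : ∀ k : J₀.1, A.as k ⟶ B.as k) (p : ∀ k : J₀.1, Y.as k ⟶ X.as k)
    (hS : ∀ k : J₀.1, S (pullback.lift (f := eHomWhiskerRight V (i k) (X.as k))
      (g := eHomWhiskerLeft V (A.as k) (p k)) (eHomWhiskerLeft V (B.as k) (p k))
      (eHomWhiskerRight V (i k) (Y.as k)) (eHom_whisker_exchange V (i k) (p k)))) :
    S (pullback.lift (f := eHomWhiskerRight V (homOfFamily i) X)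
      (g := eHomWhiskerLeft V A (homOfFamily p)) (eHomWhiskerLeft V B (homOfFamily p))
      (eHomWhiskerRight V (homOfFamily i) Y)
      (eHom_whisker_exchange V (homOfFamily i) (homOfFamily p))) :=
  pullback_lift_mem S (h.isColimitCocone B Y) (h.isColimitCocone B X) (h.isColimitCocone A Y)
    (h.isColimitCocone A X) hS (fun _ hJ => h.inducedι_eHomWhiskerLeft_of_le hJ B p)
    (fun _ hJ => h.inducedι_eHomWhiskerRight_of_le hJ i Y)
    (fun _ hJ => h.inducedι_eHomWhiskerRight_of_le hJ i X)
    (fun _ hJ => h.inducedι_eHomWhiskerLeft_of_le hJ A p) _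

end PullbackHom

/-! ### Tensors, cotensors and the pullback-hom axiom for the filter product. -/

section CompactlyEnriched

variable (V : Type u₃) [Category.{v₃} V] [MonoidalCategory V] [ModelCategory V]
  {I : Type w} {Φ : Filter I} {M : Type u₁} [Category.{v₁} M] [ModelCategory M]
  [HasStrictInitialObjects M] [CompactlyEnriched.{w} V M]

variable (M Φ) in
/-- The tensors of the filter product by compact objects. -/
abbrev productTensor : FilterProduct M Φ ⥤ CompactObj.{w} V ⥤ FilterProduct M Φ :=
  ((CompactlyEnriched.tensor (V := V) (M := M)).flip ⋙ mapFunctorFunctor Φ).flip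

variable (M Φ) in
/-- The cotensors of the filter product by compact objects. -/
abbrev productCotensor : (CompactObj.{w} V)ᵒᵖ ⥤ FilterProduct M Φ ⥤ FilterProduct M Φ :=
  CompactlyEnriched.cotensor (V := V) (M := M) ⋙ mapFunctorFunctor Φ

variable {X Y : FilterProduct M Φ} {J : Members Φ}

lemma productTensor_map_homOfFamily_app (f : ∀ i : J.1, X.as i ⟶ Y.as i) (K : CompactObj.{w} V) :
    ((productTensor V Φ M).map (homOfFamily f)).app K =
      homOfFamily (X := ((productTensor V Φ M).obj X).obj K)
        (Y := ((productTensor V Φ M).obj Y).obj K)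
        fun i => (CompactlyEnriched.tensor.map (f i)).app K :=
  mapFunctor_map_homOfFamily (CompactlyEnriched.tensor.flip.obj K) f

lemma productTensor_obj_map (X : FilterProduct M Φ) (J : Members Φ) {K K' : CompactObj.{w} V}
    (k : K ⟶ K') :
    ((productTensor V Φ M).obj X).map k =
      homOfFamily (X := ((productTensor V Φ M).obj X).obj K)
        (Y := ((productTensor V Φ M).obj X).obj K')
        fun i : J.1 => (CompactlyEnriched.tensor.obj (X.as i)).map k :=
  homOfApp_eq_homOfFamily (X := ((productTensor V Φ M).obj X).obj K)
    (Y := ((productTensor V Φ M).obj X).obj K')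
    (fun i => (CompactlyEnriched.tensor.obj (X.as i)).map k) J

lemma productCotensor_obj_map_homOfFamily (f : ∀ i : J.1, X.as i ⟶ Y.as i)
    (K : (CompactObj.{w} V)ᵒᵖ) :
    ((productCotensor V Φ M).obj K).map (homOfFamily f) =
      homOfFamily (X := ((productCotensor V Φ M).obj K).obj X)
        (Y := ((productCotensor V Φ M).obj K).obj Y)
        fun i => (CompactlyEnriched.cotensor.obj K).map (f i) :=
  mapFunctor_map_homOfFamily (CompactlyEnriched.cotensor.obj K) f

lemma productCotensor_map_app (X : FilterProduct M Φ) (J : Members Φ)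
    {K K' : (CompactObj.{w} V)ᵒᵖ} (k : K ⟶ K') :
    ((productCotensor V Φ M).map k).app X =
      homOfFamily (X := ((productCotensor V Φ M).obj K).obj X)
        (Y := ((productCotensor V Φ M).obj K').obj X)
        fun i : J.1 => (CompactlyEnriched.cotensor.map k).app (X.as i) :=
  homOfApp_eq_homOfFamily (X := ((productCotensor V Φ M).obj K).obj X)
    (Y := ((productCotensor V Φ M).obj K').obj X)
    (fun i => (CompactlyEnriched.cotensor.map k).app (X.as i)) J

variable [∀ J : Set I, HasProductsOfShape J V] [QuotientCompatible.{w} V]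

/-- The members of `Φ` form a filtered index category in the universe `w`, which is the size for
which quotient compatibility is assumed. -/
instance preservesColimitsOfShape_tensorLeft (X : V) :
    PreservesColimitsOfShape (Members Φ)ᵒᵖ (tensorLeft X) :=
  have := QuotientCompatible.tensorLeft_preserves.{w} X
  inferInstance

instance preservesColimitsOfShape_tensorRight (X : V) :
    PreservesColimitsOfShape (Members Φ)ᵒᵖ (tensorRight X) :=
  have := QuotientCompatible.tensorRight_preserves.{w} X
  inferInstance

attribute [instance] QuotientCompatible.unit_compact QuotientCompatible.fibrations_stable
  QuotientCompatible.trivialFibrations_stable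

/-- The identification `Hom(X ⊗ K, Y) ≃ Hom(K, Map(X, Y))` for the filter product. -/
def productTensorHomEquiv (X Y : FilterProduct M Φ) (K : CompactObj.{w} V) :
    (((productTensor V Φ M).obj X).obj K ⟶ Y) ≃ (K.obj ⟶ (mapCocone V X Y).pt) :=
  have : IsFinitelyPresentable.{w} K.obj := K.property
  homEquivOfCompact (X := ((productTensor V Φ M).obj X).obj K) (mapCoconeIsColimit V X Y)
    fun i => CompactlyEnriched.tensorHomEquiv (X.as i) (Y.as i) K

lemma productTensorHomEquiv_homOfFamily {K : CompactObj.{w} V}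
    (φ : ∀ i : J.1, (CompactlyEnriched.tensor.obj (X.as i)).obj K ⟶ Y.as i) :
    productTensorHomEquiv V X Y K (homOfFamily (X := ((productTensor V Φ M).obj X).obj K) φ) =
      Pi.lift (f := fun i : J.1 => (X.as i ⟶[V] Y.as i))
        (fun i => CompactlyEnriched.tensorHomEquiv (X.as i) (Y.as i) K (φ i)) ≫
        fromProd (mapCocone V X Y) J :=
  have : IsFinitelyPresentable.{w} K.obj := K.property
  homEquivOfCompact_homOfFamily (X := ((productTensor V Φ M).obj X).obj K)
    (mapCoconeIsColimit V X Y)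
    (fun i => CompactlyEnriched.tensorHomEquiv (X.as i) (Y.as i) K) φ

/-- The identification `Hom(X, Y ^ K) ≃ Hom(K, Map(X, Y))` for the filter product. -/
def productCotensorHomEquiv (X Y : FilterProduct M Φ) (K : CompactObj.{w} V) :
    (X ⟶ ((productCotensor V Φ M).obj (op K)).obj Y) ≃ (K.obj ⟶ (mapCocone V X Y).pt) :=
  have : IsFinitelyPresentable.{w} K.obj := K.property
  homEquivOfCompact (Y := ((productCotensor V Φ M).obj (op K)).obj Y) (mapCoconeIsColimit V X Y)
    fun i => CompactlyEnriched.cotensorHomEquiv (X.as i) (Y.as i) K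

lemma productCotensorHomEquiv_homOfFamily {K : CompactObj.{w} V}
    (φ : ∀ i : J.1, X.as i ⟶ (CompactlyEnriched.cotensor.obj (op K)).obj (Y.as i)) :
    productCotensorHomEquiv V X Y K
        (homOfFamily (Y := ((productCotensor V Φ M).obj (op K)).obj Y) φ) =
      Pi.lift (f := fun i : J.1 => (X.as i ⟶[V] Y.as i))
        (fun i => CompactlyEnriched.cotensorHomEquiv (X.as i) (Y.as i) K (φ i)) ≫
        fromProd (mapCocone V X Y) J :=
  have : IsFinitelyPresentable.{w} K.obj := K.property
  homEquivOfCompact_homOfFamily (Y := ((productCotensor V Φ M).obj (op K)).obj Y)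
    (mapCoconeIsColimit V X Y)
    (fun i => CompactlyEnriched.cotensorHomEquiv (X.as i) (Y.as i) K) φ

section

attribute [local instance] filterProductEnrichment

/-- Once `f`, `g` and `φ` are represented over a common member, both sides are given by families at
that stage, and these agree by naturality in `M` at each index. -/
lemma productTensorHomEquiv_naturality {X X' Y Y' : FilterProduct M Φ} {K K' : CompactObj.{w} V}
    (f : X' ⟶ X) (g : Y ⟶ Y') (k : K' ⟶ K) (φ : ((productTensor V Φ M).obj X).obj K ⟶ Y) :
    productTensorHomEquiv V X' Y' K'
        (((productTensor V Φ M).map f).app K' ≫ ((productTensor V Φ M).obj X).map k ≫ φ ≫ g) =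
      k.hom ≫ productTensorHomEquiv V X Y K φ ≫ eHomWhiskerRight V f Y ≫
        eHomWhiskerLeft V X' g := by
  obtain ⟨J₁, h₁⟩ := exists_homOfFamily_eq f
  obtain ⟨J₂, h₂⟩ := exists_homOfFamily_eq g
  obtain ⟨J₃, h₃⟩ := exists_homOfFamily_eq φ
  obtain ⟨f, rfl⟩ := h₁ (J₁ ⊓ J₂ ⊓ J₃) (inf_le_left.trans inf_le_left)
  obtain ⟨g, rfl⟩ := h₂ (J₁ ⊓ J₂ ⊓ J₃) (inf_le_left.trans inf_le_right)
  obtain ⟨φ, rfl⟩ := h₃ (J₁ ⊓ J₂ ⊓ J₃) inf_le_right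
  refine (congrArg (productTensorHomEquiv V X' Y' K') ((congrArg₂ (· ≫ ·)
    (productTensor_map_homOfFamily_app V f K') ((congrArg₂ (· ≫ ·) (productTensor_obj_map V X _ k)
      (homOfFamily_comp φ g)).trans (homOfFamily_comp _ _))).trans (homOfFamily_comp _ _))).trans ?_
  refine (productTensorHomEquiv_homOfFamily V _).trans (Eq.trans ?_
    ((congrArg (fun t => k.hom ≫ t ≫ _) (productTensorHomEquiv_homOfFamily V φ)).trans
    ((isInducedEnrichment_filterProductEnrichment V).comp_lift_whisker k.hom _ f g)).symm)
  refine congrArg (fun t => Pi.lift t ≫ _) (funext fun i => ?_)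
  exact CompactlyEnriched.tensorHomEquiv_naturality (f i) (g i) k (φ i)

lemma productCotensorHomEquiv_naturality {X X' Y Y' : FilterProduct M Φ}
    {K K' : CompactObj.{w} V} (f : X' ⟶ X) (g : Y ⟶ Y') (k : K' ⟶ K)
    (φ : X ⟶ ((productCotensor V Φ M).obj (op K)).obj Y) :
    productCotensorHomEquiv V X' Y' K' (f ≫ φ ≫ ((productCotensor V Φ M).map k.op).app Y ≫
        ((productCotensor V Φ M).obj (op K')).map g) =
      k.hom ≫ productCotensorHomEquiv V X Y K φ ≫ eHomWhiskerRight V f Y ≫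
        eHomWhiskerLeft V X' g := by
  obtain ⟨J₁, h₁⟩ := exists_homOfFamily_eq f
  obtain ⟨J₂, h₂⟩ := exists_homOfFamily_eq g
  obtain ⟨J₃, h₃⟩ := exists_homOfFamily_eq φ
  obtain ⟨f, rfl⟩ := h₁ (J₁ ⊓ J₂ ⊓ J₃) (inf_le_left.trans inf_le_left)
  obtain ⟨g, rfl⟩ := h₂ (J₁ ⊓ J₂ ⊓ J₃) (inf_le_left.trans inf_le_right)
  obtain ⟨φ, rfl⟩ := h₃ (J₁ ⊓ J₂ ⊓ J₃) inf_le_right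
  refine (congrArg (productCotensorHomEquiv V X' Y' K') ((congrArg (_ ≫ ·) ((congrArg (_ ≫ ·)
    ((congrArg₂ (· ≫ ·) (productCotensor_map_app V Y _ k.op)
      (productCotensor_obj_map_homOfFamily V g (op K'))).trans (homOfFamily_comp _ _))).trans
    (homOfFamily_comp _ _))).trans (homOfFamily_comp _ _))).trans ?_
  refine (productCotensorHomEquiv_homOfFamily V _).trans (Eq.trans ?_
    ((congrArg (fun t => k.hom ≫ t ≫ _) (productCotensorHomEquiv_homOfFamily V φ)).trans
    ((isInducedEnrichment_filterProductEnrichment V).comp_lift_whisker k.hom _ f g)).symm)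
  refine congrArg (fun t => Pi.lift t ≫ _) (funext fun i => ?_)
  exact CompactlyEnriched.cotensorHomEquiv_naturality (f i) (g i) k (φ i)

variable [AB5OfSize.{w, w} V]

/-- If the pullback-homs of the morphisms in `S₁` with the morphisms in `S₂` belong to `S`, then so
does the pullback-hom of morphisms of the filter product whose components belong eventually to
`S₁` and `S₂`. -/
lemma pullbackHom_mem_of_eventually {S₁ S₂ : MorphismProperty M} (S : MorphismProperty V)
    [S.RespectsIso] [∀ J : Set I, S.IsStableUnderProductsOfShape J]
    [MorphismProperty.IsStableUnderFilteredColimits.{w, w} S]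
    (hS : ∀ {A B X Y : M} (i : A ⟶ B) (p : Y ⟶ X), S₁ i → S₂ p →
      S (pullback.lift (f := eHomWhiskerRight V i X) (g := eHomWhiskerLeft V A p)
        (eHomWhiskerLeft V B p) (eHomWhiskerRight V i Y) (eHom_whisker_exchange V i p)))
    {A B X Y : FilterProduct M Φ} {i : A ⟶ B} {p : Y ⟶ X}
    (hi : ∀ᶠ k in Φ, ∃ g, HasComponent i k g ∧ S₁ g)
    (hp : ∀ᶠ k in Φ, ∃ g, HasComponent p k g ∧ S₂ g) :
    S (pullback.lift (f := eHomWhiskerRight V i X) (g := eHomWhiskerLeft V A p)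
        (eHomWhiskerLeft V B p) (eHomWhiskerRight V i Y) (eHom_whisker_exchange V i p)) := by
  -- The representatives are cut down to a member on which every component lies in `S₁`,
  -- respectively `S₂`, since the gap argument needs `S` at all indices of the stage.
  obtain ⟨J, hJ⟩ : ∃ J : Members Φ, ∀ k : J.1, (∃ g, HasComponent i k.1 g ∧ S₁ g) ∧
      ∃ g, HasComponent p k.1 g ∧ S₂ g := ⟨⟨_, hi.and hp⟩, fun k => k.2⟩
  choose i' hi' hi'' using fun k => (hJ k).1
  choose p' hp' hp'' using fun k => (hJ k).2
  obtain rfl : homOfFamily i' = i := HasComponent.ext (by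
    filter_upwards [J.2, HasComponent.of_germ i'] with k hk h using ⟨_, h hk, hi' ⟨k, hk⟩⟩)
  obtain rfl : homOfFamily p' = p := HasComponent.ext (by
    filter_upwards [J.2, HasComponent.of_germ p'] with k hk h using ⟨_, h hk, hp' ⟨k, hk⟩⟩)
  exact (isInducedEnrichment_filterProductEnrichment V).pullbackHom_mem S i' p'
    fun k => hS _ _ (hi'' k) (hp'' k)

end

variable [AB5OfSize.{w, w} V] [ModelCategory (FilterProduct M Φ)]

/-- The compactly enriched structure of the filter product. -/
@[reducible]
def filterProductCompactlyEnriched (hM : IsFilterProductModel M Φ) :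
    CompactlyEnriched.{w} V (FilterProduct M Φ) where
  toEnrichedOrdinaryCategory := filterProductEnrichment V
  tensor := productTensor V Φ M
  cotensor := productCotensor V Φ M
  tensorHomEquiv := productTensorHomEquiv V
  cotensorHomEquiv := productCotensorHomEquiv V
  tensorHomEquiv_naturality := productTensorHomEquiv_naturality V
  cotensorHomEquiv_naturality := productCotensorHomEquiv_naturality V
  fibration_pullbackHom i p hi hp :=
    ⟨pullbackHom_mem_of_eventually V (S₁ := fun _ _ f => Cofibration f)
      (S₂ := fun _ _ f => Fibration f) (fibrations V)
      (fun i p hi hp => (CompactlyEnriched.fibration_pullbackHom i p hi hp).mem)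
      ((hM.cofibration_iff i).1 hi) ((hM.fibration_iff p).1 hp)⟩
  weakEquivalence_pullbackHom i p hi hp hw := by
    rw [hM.cofibration_iff] at hi
    rw [hM.fibration_iff] at hp
    rw [hM.weakEquivalence_iff, hM.weakEquivalence_iff] at hw
    rw [HomotopicalAlgebra.weakEquivalence_iff]
    -- In both cases the argument runs with trivial fibrations, not weak equivalences: the former
    -- are stable under the products and filtered colimits involved. The second half of the
    -- conclusion is then kept.
    obtain hw | hw := hw
    · refine (pullbackHom_mem_of_eventually V (S₁ := fun _ _ f => Cofibration f ∧ WeakEquivalence f)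
        (S₂ := fun _ _ f => Fibration f) (trivialFibrations V) (fun i p hi hp =>
        mem_trivialFibrations_iff _|>.2
          ⟨CompactlyEnriched.fibration_pullbackHom i p hi.1 hp,
            CompactlyEnriched.weakEquivalence_pullbackHom i p hi.1 hp (Or.inl hi.2)⟩) ?_ hp).2
      filter_upwards [hi, hw]
      rintro k ⟨g, hg, h⟩ ⟨g', hg', h'⟩
      exact ⟨g, hg, h, hg.unique hg' ▸ h'⟩
    · refine (pullbackHom_mem_of_eventually V (S₁ := fun _ _ f => Cofibration f)
        (S₂ := fun _ _ f => Fibration f ∧ WeakEquivalence f) (trivialFibrations V)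
        (fun i p hi hp => mem_trivialFibrations_iff _|>.2
          ⟨CompactlyEnriched.fibration_pullbackHom i p hi hp.1,
            CompactlyEnriched.weakEquivalence_pullbackHom i p hi hp.1 (Or.inr hp.2)⟩) hi ?_).2
      filter_upwards [hp, hw]
      rintro k ⟨g, hg, h⟩ ⟨g', hg', h'⟩
      exact ⟨g, hg, h, hg.unique hg' ▸ h'⟩

end CompactlyEnriched

end FilterModel

end

theorem mainTheorem12
    {M : Type u₁} [Category.{v₁} M] [ModelCategory M] [HasStrictInitialObjects M]
    {N : Type u₂} [Category.{v₂} N] [ModelCategory N] [HasStrictInitialObjects N]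
    {I : Type w} (Φ : Filter I) {F : M ⥤ N} {G : N ⥤ M} (adj : F ⊣ G)
    (hadj : IsQuillenAdjunction adj)
    (hF : PreservesLimit (Functor.empty.{0} M) F)
    (hG : PreservesColimit (Functor.empty.{0} N) G) :
    ∃ (_ : ModelCategory (FilterProduct M Φ)) (_ : ModelCategory (FilterProduct N Φ))
      (F' : FilterProduct M Φ ⥤ FilterProduct N Φ) (G' : FilterProduct N Φ ⥤ FilterProduct M Φ)
      (adj' : F' ⊣ G'),
      IsFilterProductModel M Φ ∧ IsFilterProductModel N Φ ∧
      IsInducedAdjunction adj Φ adj' ∧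
      IsQuillenAdjunction adj' ∧
      (IsHomotopicalLocalization adj → IsHomotopicalLocalization adj') ∧
      (IsHomotopicalColocalization adj → IsHomotopicalColocalization adj') ∧
      (IsQuillenEquivalence adj → IsQuillenEquivalence adj') ∧
      ∀ (V : Type u₃) [Category.{v₃} V] [MonoidalCategory V] [ModelCategory V]
        [MonoidalModelCategory V] [QuotientCompatible.{w} V] [AB5OfSize.{w, w} V]
        [∀ J : Set I, HasProductsOfShape J V]
        [CompactlyEnriched.{w} V M] [CompactlyEnriched.{w} V N],
        Nonempty (EnrichedAdjunction V adj) →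
        ∃ (_ : CompactlyEnriched.{w} V (FilterProduct M Φ))
          (_ : CompactlyEnriched.{w} V (FilterProduct N Φ)),
          (∃ ι, IsInducedEnrichment V (M := M) (Φ := Φ) ι) ∧
          (∃ ι, IsInducedEnrichment V (M := N) (Φ := Φ) ι) ∧
          Nonempty (EnrichedAdjunction V adj') := by
  let := filterProductModelCategory M Φ
  let := filterProductModelCategory N Φ
  have hM := isFilterProductModel_filterProductModelCategory M Φ
  have hN := isFilterProductModel_filterProductModelCategory N Φ
  refine ⟨_, _, mapFunctor Φ F, mapFunctor Φ G, mapAdjunction Φ adj, hM, hN,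
    isInducedAdjunction_mapAdjunction Φ adj, isQuillenAdjunction_mapAdjunction hM hN hadj,
    isHomotopicalLocalization_mapAdjunction hM hN, isHomotopicalColocalization_mapAdjunction hM hN,
    isQuillenEquivalence_mapAdjunction hM hN, ?_⟩
  intro V _ _ _ _ _ _ _ _ _ ⟨S⟩
  have h := isInducedEnrichment_filterProductEnrichment V (M := M) (Φ := Φ)
  have h' := isInducedEnrichment_filterProductEnrichment V (M := N) (Φ := Φ)
  -- The enrichments underlying the two compactly enriched structures are by construction
  -- `filterProductEnrichment`, so the statements about induced enrichments and the enriched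
  -- adjunction refer to the same data.
  exact ⟨filterProductCompactlyEnriched V hM, filterProductCompactlyEnriched V hN, ⟨_, h⟩, ⟨_, h'⟩,
    letI := filterProductEnrichment V (M := M) (Φ := Φ)
    letI := filterProductEnrichment V (M := N) (Φ := Φ)
    ⟨mapEnrichedAdjunction h h' S⟩⟩
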